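/- Let $k$ be a field, $A=k[x_1,\dots,x_n]$ and $\otimes=\otimes_k$. Let $TA=\bigoplus_r A^{\otimes r}$ with the deconcatenation coproduct, and let $W\subset TA$ be the subcoalgebra spanned by the orbit sums $o(v_1,\dots,v_r)=\sum_{\sigma\in S_r}\mathrm{sgn}(\sigma)\,v_{\sigma(1)}\otimes\cdots\otimes v_{\sigma(r)}$ of linear forms $v_1,\dots,v_r$, so that the $o(x_I)=o(x_{i_1},\dots,x_{i_s})$ with $i_1<\dots<i_s$ form a $k$-basis of $W$. Let $K=A\otimes W\otimes A$ be the Koszul bimodule resolution of $A$, with differential $$1\otimes o(x_I)\otimes 1\mapsto\sum_l(-1)^{l+1}\bigl(x_{i_l}\otimes o(x_{I\setminus i_l})\otimes 1-1\otimes o(x_{I\setminus i_l})\otimes x_{i_l}\bigr),$$ let $\Delta_K\colon K\to K\otimes_AK$ be the bimodule map induced by the coproduct of $W$, and put $\Delta_K^{(2)}=(\Delta_K\otimes_A\mathrm{id})\Delta_K$. Identify $K\otimes_AK=A\otimes W\otimes A\otimes W\otimes A$ and let $\phi\colon K\otimes_AK\to K$ be the $A$-bimodule map with $$\phi\bigl(1\otimes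 o(x_I)\otimes x_{j_1}\cdots x_{j_t}\otimes o(x_L)\otimes 1\bigr)=\sum_{\nu:\ \max L<j_\nu<\min I}(-1)^{|I||L|+|L|}\,x_{j_1}\cdots x_{j_{\nu-1}}\otimes o(x_L,x_{j_\nu},x_I)\otimes x_{j_{\nu+1}}\cdots x_{j_t}$$ for $I,L$ increasing and $j_1\le\dots\le j_t$ (a condition involving an empty $I$ or $L$ is void). For homogeneous $f,g\in\mathrm{Hom}_{A^e}(K,A)$ put $$f\circ_\phi g=f\,\phi\,(\mathrm{id}_K\otimes_A g\otimes_A\mathrm{id}_K)\,\Delta_K^{(2)},\qquad [f,g]_\phi=f\circ_\phi g-(-1)^{(|f|-1)(|g|-1)}g\circ_\phi f,$$ where $(\mathrm{id}\otimes g\otimes\mathrm{id})(x\otimes y\otimes z)=(-1)^{|x||g|}x\otimes g(y)\otimes z$. Let $A[\partial_1,\dots,\partial_n]$ be the free graded commutative $A$-algebra on generators $\partial_i$ of degree $1$ (the exterior algebra of $A^n$); map it $A$-linearly to $\mathrm{Hom}_{A^e}(K,A)$ by sending $\partial_I=\partial_{i_1}\cdots\partial_{i_s}$ to the function dual to $(-1)^{1+2+\cdots+(s-1)}o(x_{i_1},\dots,x_{i_s})$.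 (1) This map is an isomorphism $A[\partial_1,\dots,\partial_n]\cong\mathrm{Hom}_{A^e}(K,A)$, and the differential of the complex $\mathrm{Hom}_{A^e}(K,A)$ is zero, so that this complex equals its own cohomology $\mathrm{HH}(A)$. (2) For all $a,b\in A$ and all finite sequences $I=(i_1,\dots,i_{|I|})$, $J=(j_1,\dots,j_{|J|})$ in $\{1,\dots,n\}$ (in particular for ordered subsets), writing $I(r)=(i_1,\dots,i_{r-1})$, $I'(r)=(i_{r+1},\dots,i_{|I|})$ and $\amalg$ for concatenation, $$(a\partial_I)\circ_\phi(b\partial_J)=\sum_{1\le r\le|I|}(-1)^{(|I|-r)(|J|-1)}\,a\,\frac{\partial b}{\partial x_{i_r}}\,\partial_{I(r)\amalg J\amalg I'(r)}.$$ (3) Likewise $$[a\partial_I,b\partial_J]_\phi=\sum_{1\le r\le|I|}(-1)^{(|I|-r)(|J|-1)}a\frac{\partial b}{\partial x_{i_r}}\partial_{I(r)\amalg J\amalg I'(r)}-\sum_{1\le l\le|J|}(-1)^{(l-1)(|I|-1)}b\frac{\partial a}{\partial x_{j_l}}\partial_{J(l)\amalg I\amalg J'(l)}.$$ (4) Under the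 isomorphism of (1), $[\ ,\ ]_\phi$ is the Schouten–Nijenhuis bracket, that is, the unique $k$-bilinear operation on $A[\partial_1,\dots,\partial_n]$ with $[a,b]=0$, $[a\partial_i,b]=a\frac{\partial b}{\partial x_i}$ and $[a\partial_i,b\partial_j]=a\frac{\partial b}{\partial x_i}\partial_j-b\frac{\partial a}{\partial x_j}\partial_i$ for $a,b\in A$, and with $[\omega,\eta]=-(-1)^{(|\omega|-1)(|\eta|-1)}[\eta,\omega]$ and $[\omega,\eta\zeta]=[\omega,\eta]\zeta+(-1)^{(|\omega|-1)|\eta|}\eta[\omega,\zeta]$ for homogeneous $\omega,\eta$ and arbitrary $\zeta$. -/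

import Mathlib

open scoped TensorProduct DirectSum

noncomputable section

namespace KoszulPoly

variable (k : Type*) [Field k] (n : ℕ)

/-- The polynomial ring `A = k[x_1, …, x_n]`. -/
abbrev A : Type _ := MvPolynomial (Fin n) k

/-! ### The tensor coalgebra and the subcoalgebra of orbit sums -/

/-- The tensor coalgebra `TA = ⨁_r A^{⊗ r}`. -/
abbrev TA : Type _ := ⨁ r : ℕ, ⨂[k]^r (A k n)

/-- The component `A^{⊗ r} → A^{⊗ i} ⊗ A^{⊗ j}` (`i + j = r`) of deconcatenation:
`a_1 ⊗ ⋯ ⊗ a_r ↦ (a_1 ⊗ ⋯ ⊗ a_i) ⊗ (a_{i+1} ⊗ ⋯ ⊗ a_r)`. -/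
def splitAt {r i j : ℕ} (h : r = i + j) :
    ⨂[k]^r (A k n) →ₗ[k] (⨂[k]^i (A k n)) ⊗[k] (⨂[k]^j (A k n)) :=
  (TensorPower.mulEquiv (R := k) (M := A k n) (n := i) (m := j)).symm.toLinearMap ∘ₗ
    (TensorPower.cast k (A k n) h).toLinearMap

/-- The deconcatenation coproduct
`Δ(a_1 ⊗ ⋯ ⊗ a_r) = ∑_{i=0}^r (a_1 ⊗ ⋯ ⊗ a_i) ⊗ (a_{i+1} ⊗ ⋯ ⊗ a_r)` of `TA`. -/
def comulTA : TA k n →ₗ[k] TA k n ⊗[k] TA k n :=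
  DirectSum.toModule k ℕ _ fun r => ∑ i : Fin (r + 1),
    TensorProduct.map
        (DirectSum.lof k ℕ (fun r => ⨂[k]^r (A k n)) (i : ℕ))
        (DirectSum.lof k ℕ (fun r => ⨂[k]^r (A k n)) (r - i)) ∘ₗ
      splitAt k n (show r = (i : ℕ) + (r - i) by have := i.2; omega)

/-- The space `V` of linear forms, spanned by `x_1, …, x_n`. -/
def V : Submodule k (A k n) := Submodule.span k (Set.range MvPolynomial.X)

/-- The orbit sum `o(v_1, …, v_r) = ∑_σ sgn(σ) v_{σ(1)} ⊗ ⋯ ⊗ v_{σ(r)}`. -/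
def orbitSum (r : ℕ) : (A k n) [⋀^Fin r]→ₗ[k] ⨂[k]^r (A k n) :=
  MultilinearMap.alternatization (PiTensorProduct.tprod k)

/-- The graded subspace `W ⊆ TA` spanned by the orbit sums of linear forms. -/
def W : Submodule k (TA k n) :=
  Submodule.span k {t | ∃ (r : ℕ) (v : Fin r → A k n), (∀ i, v i ∈ V k n) ∧
    t = DirectSum.lof k ℕ (fun r => ⨂[k]^r (A k n)) r (orbitSum k n r v)}

variable {k n} in
theorem orbitSum_mem_W {r : ℕ} (v : Fin r → A k n) (hv : ∀ i, v i ∈ V k n) :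
    DirectSum.lof k ℕ (fun r => ⨂[k]^r (A k n)) r (orbitSum k n r v) ∈ W k n :=
  Submodule.subset_span ⟨r, v, hv, rfl⟩

variable {n} in
theorem X_mem_V (i : Fin n) : (MvPolynomial.X i : A k n) ∈ V k n :=
  Submodule.subset_span ⟨i, rfl⟩

variable {n} in
/-- `o(x_{i_1}, …, x_{i_r}) ∈ W` for a finite sequence of indices `(i_1, …, i_r)`. -/
def o (l : List (Fin n)) : W k n :=
  ⟨DirectSum.lof k ℕ (fun r => ⨂[k]^r (A k n)) l.length
      (orbitSum k n l.length fun j => MvPolynomial.X (l.get j)),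
    orbitSum_mem_W _ fun _ => X_mem_V k _⟩

/-- The coefficient of `x_{i_1} ⊗ ⋯ ⊗ x_{i_s}`, `I = {i_1 < ⋯ < i_s}`, in an element of `TA`. -/
def coeffTA (I : Finset (Fin n)) : TA k n →ₗ[k] k :=
  DirectSum.toModule k ℕ _ fun r =>
    if h : I.card = r then
      PiTensorProduct.lift ((MultilinearMap.mkPiAlgebra k (Fin r) k).compLinearMap
        fun j => MvPolynomial.lcoeff k (Finsupp.single (I.orderEmbOfFin h j) 1))
    else 0

theorem o_sort_coe (J : Finset (Fin n)) {r : ℕ} (h : J.card = r) :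
    (o k J.sort : TA k n) = DirectSum.lof k ℕ (fun r => ⨂[k]^r (A k n)) r
      (orbitSum k n r fun j => MvPolynomial.X (J.orderEmbOfFin h j)) := by
  obtain rfl : J.sort.length = r := by simp [h]
  rfl

theorem coeffTA_o (I J : Finset (Fin n)) :
    coeffTA k n I (o k J.sort : TA k n) = if I = J then 1 else 0 := by
  rw [o_sort_coe k n J rfl, coeffTA, DirectSum.toModule_lof]
  by_cases h : I.card = J.card
  · rw [dif_pos h]
    simp only [orbitSum, MultilinearMap.alternatization_apply, map_sum,
      MultilinearMap.domDomCongr_apply]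
    by_cases hIJ : I = J
    · subst hIJ
      rw [if_pos rfl, Finset.sum_eq_single 1]
      · simp [PiTensorProduct.lift.tprod, MvPolynomial.coeff_X]
      · intro σ _ hσ
        obtain ⟨j, hj⟩ : ∃ j, σ j ≠ j := by
          by_contra hc
          push Not at hc
          exact hσ (Equiv.ext hc)
        rw [map_zsmul_unit, PiTensorProduct.lift.tprod, MultilinearMap.compLinearMap_apply,
          MultilinearMap.mkPiAlgebra_apply, Finset.prod_eq_zero (Finset.mem_univ j), smul_zero]
        simp [MvPolynomial.lcoeff, MvPolynomial.coeff_X, Finsupp.single_left_inj, hj]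
      · simp
    · rw [if_neg hIJ]
      refine Finset.sum_eq_zero fun σ _ => ?_
      obtain ⟨j, hj⟩ : ∃ j, J.orderEmbOfFin rfl (σ j) ≠ I.orderEmbOfFin h j := by
        by_contra hc
        push Not at hc
        apply hIJ
        have h1 : Set.range (I.orderEmbOfFin h) = Set.range (J.orderEmbOfFin rfl) := by
          rw [← σ.surjective.range_comp (J.orderEmbOfFin rfl)]
          congr 1
          funext j
          exact (hc j).symm
        simpa using h1
      rw [map_zsmul_unit, PiTensorProduct.lift.tprod, MultilinearMap.compLinearMap_apply,
        MultilinearMap.mkPiAlgebra_apply, Finset.prod_eq_zero (Finset.mem_univ j), smul_zero]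
      simp [MvPolynomial.lcoeff, MvPolynomial.coeff_X, Finsupp.single_left_inj, hj]
  · rw [dif_neg h, if_neg (fun e => h (by rw [e])), LinearMap.zero_apply]

theorem linearIndependent_o : LinearIndependent k fun I : Finset (Fin n) => o k I.sort := by
  rw [linearIndependent_iff'ₛ]
  intro s f g hfg I hI
  have h := congrArg (fun w : W k n => coeffTA k n I (w : TA k n)) hfg
  simpa [map_sum, coeffTA_o, hI] using h

theorem W_le_span :
    W k n ≤ Submodule.span k (Set.range fun I : Finset (Fin n) => (o k I.sort : TA k n)) := by
  refine Submodule.span_le.2 ?_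
  rintro _ ⟨r, v, hv, rfl⟩
  let x : Fin n → V k n := fun i => ⟨MvPolynomial.X i, X_mem_V k i⟩
  have hx : Submodule.span k (Set.range x) = ⊤ := by
    apply Submodule.map_injective_of_injective (V k n).injective_subtype
    rw [Submodule.map_span, ← Set.range_comp, Submodule.map_top, Submodule.range_subtype]
    rfl
  let F : ⋀[k]^r (V k n) →ₗ[k] TA k n :=
    DirectSum.lof k ℕ (fun r => ⨂[k]^r (A k n)) r ∘ₗ
      exteriorPower.alternatingMapLinearEquiv
        ((orbitSum k n r).compLinearMap (V k n).subtype)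
  have hF : ∀ u : Fin r → V k n, F (exteriorPower.ιMulti k r u) =
      DirectSum.lof k ℕ (fun r => ⨂[k]^r (A k n)) r (orbitSum k n r fun i => (u i : A k n)) := by
    intro u
    simp only [F, LinearMap.comp_apply, exteriorPower.alternatingMapLinearEquiv_apply_ιMulti,
      AlternatingMap.compLinearMap_apply]
    rfl
  have h1 := hF fun i => ⟨v i, hv i⟩
  simp only at h1
  rw [SetLike.mem_coe, ← h1]
  have h2 : exteriorPower.ιMulti k r (fun i => (⟨v i, hv i⟩ : V k n)) ∈
      Submodule.span k (Set.range (exteriorPower.ιMulti_family k r x)) := by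
    rw [exteriorPower.ιMulti_family_span_of_span k hx]
    trivial
  have h3 := Submodule.mem_map_of_mem (f := F) h2
  rw [Submodule.map_span, ← Set.range_comp] at h3
  refine Submodule.span_mono ?_ h3
  rintro _ ⟨s, rfl⟩
  refine ⟨s.1, ?_⟩
  change (o k s.1.sort : TA k n) = F (exteriorPower.ιMulti k r _)
  rw [hF, o_sort_coe k n s.1 s.2]
  rfl

theorem span_o : ⊤ ≤ Submodule.span k (Set.range fun I : Finset (Fin n) => o k I.sort) := by
  have h : Submodule.map (W k n).subtype ⊤ ≤ Submodule.map (W k n).subtype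
      (Submodule.span k (Set.range fun I : Finset (Fin n) => o k I.sort)) := by
    rw [Submodule.map_top, Submodule.range_subtype, Submodule.map_span, ← Set.range_comp]
    exact W_le_span k n
  exact (Submodule.map_le_map_iff_of_injective (W k n).injective_subtype _ _).1 h

/-- The basis of `W` given by `o(x_{i_1}, …, x_{i_s})`, `i_1 < ⋯ < i_s`. -/
def basisW : Module.Basis (Finset (Fin n)) k (W k n) :=
  Module.Basis.mk (linearIndependent_o k n) (span_o k n)

theorem domCoprod_mem {R M N₁ N₂ ιa ιb : Type*} [CommRing R] [AddCommGroup M] [Module R M]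
    [AddCommGroup N₁] [Module R N₁] [AddCommGroup N₂] [Module R N₂]
    [Fintype ιa] [Fintype ιb] [DecidableEq ιa] [DecidableEq ιb]
    (a : M [⋀^ιa]→ₗ[R] N₁) (b : M [⋀^ιb]→ₗ[R] N₂) (S : Submodule R (N₁ ⊗[R] N₂))
    (v : ιa ⊕ ιb → M)
    (h : ∀ σ : Equiv.Perm (ιa ⊕ ιb),
      (a fun i => v (σ (Sum.inl i))) ⊗ₜ[R] (b fun i => v (σ (Sum.inr i))) ∈ S) :
    a.domCoprod b v ∈ S := by
  rw [AlternatingMap.domCoprod_apply, sum_apply]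
  refine Submodule.sum_mem _ fun σ _ => ?_
  induction σ using Quotient.inductionOn' with
  | h σ =>
    rw [AlternatingMap.domCoprod.summand_mk'', smul_apply]
    exact Submodule.smul_of_tower_mem _ _ (h σ)

theorem splitAt_orbitSum_mem {r i j : ℕ} (h : r = i + j) (v : Fin r → A k n)
    (hv : ∀ l, v l ∈ V k n) :
    TensorProduct.map
        (DirectSum.lof k ℕ (fun r => ⨂[k]^r (A k n)) i)
        (DirectSum.lof k ℕ (fun r => ⨂[k]^r (A k n)) j)
      (splitAt k n h (orbitSum k n r v)) ∈
    LinearMap.range (TensorProduct.map (W k n).subtype (W k n).subtype) := by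
  subst h
  have key : splitAt k n rfl (orbitSum k n (i + j) v) =
      ((orbitSum k n i).domCoprod (orbitSum k n j)) (fun s => v (finSumFinEquiv s)) := by
    rw [orbitSum, orbitSum, orbitSum, ← MultilinearMap.domCoprod_alternization,
      MultilinearMap.alternatization_apply, MultilinearMap.alternatization_apply, map_sum]
    refine Fintype.sum_equiv finSumFinEquiv.symm.permCongr _ _ fun σ => ?_
    rw [map_zsmul_unit, Equiv.Perm.sign_permCongr]
    congr 1
    simp only [MultilinearMap.domDomCongr_apply, MultilinearMap.domCoprod_apply]
    rw [splitAt, TensorPower.cast_refl]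
    simp only [LinearMap.comp_apply, LinearEquiv.coe_coe, LinearEquiv.refl_apply]
    rw [LinearEquiv.symm_apply_eq, ← TensorPower.gMul_def, TensorPower.tprod_mul_tprod]
    congr 1
    funext l
    refine Fin.addCases (fun l => ?_) (fun l => ?_) l <;> simp
  rw [key, ← Submodule.mem_comap]
  refine domCoprod_mem _ _ _ _ fun σ => ?_
  exact ⟨⟨_, orbitSum_mem_W _ fun _ => hv _⟩ ⊗ₜ ⟨_, orbitSum_mem_W _ fun _ => hv _⟩, rfl⟩

theorem comulTA_mem (w : W k n) : comulTA k n w ∈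
    LinearMap.range (TensorProduct.map (W k n).subtype (W k n).subtype) := by
  suffices h : W k n ≤ (LinearMap.range
      (TensorProduct.map (W k n).subtype (W k n).subtype)).comap (comulTA k n) from h w.2
  refine Submodule.span_le.2 ?_
  rintro _ ⟨r, v, hv, rfl⟩
  rw [SetLike.mem_coe, Submodule.mem_comap, comulTA, DirectSum.toModule_lof, LinearMap.sum_apply]
  exact Submodule.sum_mem _ fun i _ => splitAt_orbitSum_mem k n _ v hv

theorem map_subtype_injective :
    Function.Injective (TensorProduct.map (W k n).subtype (W k n).subtype) :=
  have : Module.Free k (W k n) := Module.Free.of_basis (basisW k n)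
  TensorProduct.map_injective_of_flat_flat _ _ (W k n).injective_subtype
    (W k n).injective_subtype

/-- The coproduct of the subcoalgebra `W ⊆ TA`: the restriction of deconcatenation. -/
def comulW : W k n →ₗ[k] W k n ⊗[k] W k n :=
  (LinearEquiv.ofInjective _ (map_subtype_injective k n)).symm.toLinearMap ∘ₗ
    (comulTA k n ∘ₗ (W k n).subtype).codRestrict _ (comulTA_mem k n)

/-! ### The Koszul resolution -/

/-- The bimodule tensor product `K ⊗_A X`, where `K = A ⊗ W ⊗ A`, in the form `A ⊗ W ⊗ X`:
the element `(a ⊗ w ⊗ a') ⊗_A x` is `a ⊗ w ⊗ a' x`. All unadorned tensor products are over `k`. -/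
abbrev KTensor (X : Type*) [AddCommMonoid X] [Module k X] : Type _ :=
  A k n ⊗[k] (W k n ⊗[k] X)

/-- `K = A ⊗ W ⊗ A`. -/
abbrev K : Type _ := KTensor k n (A k n)

/-- `K ⊗_A K = A ⊗ W ⊗ A ⊗ W ⊗ A`. -/
abbrev KK : Type _ := KTensor k n (K k n)

/-- `K ⊗_A K ⊗_A K = A ⊗ W ⊗ A ⊗ W ⊗ A ⊗ W ⊗ A`. -/
abbrev KKK : Type _ := KTensor k n (KK k n)

/-- The left action of `A` on `K`: `b · (a ⊗ w ⊗ a') = b a ⊗ w ⊗ a'`. -/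
def lact : A k n →ₗ[k] K k n →ₗ[k] K k n :=
  LinearMap.rTensorHom (W k n ⊗[k] A k n) ∘ₗ LinearMap.mul k (A k n)

/-- The right action of `A` on `K`: `(a ⊗ w ⊗ a') · b = a ⊗ w ⊗ a' b`. -/
def ract : A k n →ₗ[k] K k n →ₗ[k] K k n :=
  LinearMap.lTensorHom (A k n) ∘ₗ LinearMap.lTensorHom (W k n) ∘ₗ (LinearMap.mul k (A k n)).flip

/-- The map `A ⊗ K ⊗ A → K`, `a ⊗ z ⊗ a' ↦ a · z · a'`. -/
def biact : A k n ⊗[k] (K k n ⊗[k] A k n) →ₗ[k] K k n :=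
  TensorProduct.lift (lact k n) ∘ₗ LinearMap.lTensor (A k n) (TensorProduct.lift (ract k n).flip)

/-- The differential of `K`: the bimodule map with
`1 ⊗ o(x_{i_1}, …, x_{i_s}) ⊗ 1 ↦ ∑_l (-1)^{l+1} (x_{i_l} ⊗ o(…, x̂_{i_l}, …) ⊗ 1
  - 1 ⊗ o(…, x̂_{i_l}, …) ⊗ x_{i_l})`; below, `l` is counted from `0`. -/
def koszulD : K k n →ₗ[k] K k n :=
  biact k n ∘ₗ LinearMap.lTensor (A k n) (LinearMap.rTensor (A k n)
    ((basisW k n).constr k fun I => ∑ l : Fin I.sort.length, (-1 : k) ^ (l : ℕ) •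
      ((MvPolynomial.X I.sort[l] : A k n) ⊗ₜ[k] (o k (I.sort.eraseIdx l) ⊗ₜ[k] (1 : A k n)) -
        (1 : A k n) ⊗ₜ[k] (o k (I.sort.eraseIdx l) ⊗ₜ[k] (MvPolynomial.X I.sort[l] : A k n)))))

/-- The map `Δ_K ⊗_A id_X : K ⊗_A X → K ⊗_A K ⊗_A X`,
`a ⊗ w ⊗ x ↦ ∑ a ⊗ w_1 ⊗ 1 ⊗ w_2 ⊗ x`. -/
def comulTensor (X : Type*) [AddCommMonoid X] [Module k X] :
    KTensor k n X →ₗ[k] KTensor k n (KTensor k n X) :=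
  LinearMap.lTensor (A k n)
    (LinearMap.lTensor (W k n) (TensorProduct.mk k (A k n) (W k n ⊗[k] X) 1) ∘ₗ
      (TensorProduct.assoc k (W k n) (W k n) X).toLinearMap ∘ₗ
        LinearMap.rTensor X (comulW k n))

/-- The diagonal `Δ_K : K → K ⊗_A K`, `a ⊗ w ⊗ a' ↦ ∑ (a ⊗ w_1 ⊗ 1) ⊗_A (1 ⊗ w_2 ⊗ a')`. -/
def comulK : K k n →ₗ[k] KK k n := comulTensor k n (A k n)

/-- `Δ_K^{(2)} = (Δ_K ⊗_A id_K) Δ_K : K → K ⊗_A K ⊗_A K`. -/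
def comulK₂ : K k n →ₗ[k] KKK k n := comulTensor k n (K k n) ∘ₗ comulK k n

variable {n} in
/-- The value of `φ` on the ordered monomial `1 ⊗ o(x_I) ⊗ x^m ⊗ o(x_L) ⊗ 1`, where
`x^m = x_{j_1} ⋯ x_{j_t}` with `j_1 ≤ ⋯ ≤ j_t`:
`∑_{max L < j_ν < min I} (-1)^{|I||L|+|L|} x_{j_1} ⋯ x_{j_{ν-1}} ⊗ o(x_L, x_{j_ν}, x_I) ⊗
x_{j_{ν+1}} ⋯ x_{j_t}`. A condition on an empty `I` or `L` is void. -/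
def phiMonomial (I : Finset (Fin n)) (m : Fin n →₀ ℕ) (L : Finset (Fin n)) : K k n :=
  let j : List (Fin n) := (Finsupp.toMultiset m).sort
  ∑ ν : Fin j.length, if (∀ l ∈ L, l < j[ν]) ∧ (∀ i ∈ I, j[ν] < i) then
    (-1 : k) ^ (I.card * L.card + L.card) •
      (((j.take ν).map MvPolynomial.X).prod ⊗ₜ[k]
        (o k (L.sort ++ j[ν] :: I.sort) ⊗ₜ[k] ((j.drop (ν + 1)).map MvPolynomial.X).prod))
  else 0

/-- `φ` on the generating subspace `k ⊗ W ⊗ A ⊗ W ⊗ k` of `K ⊗_A K`. -/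
def phiGen : W k n →ₗ[k] A k n →ₗ[k] W k n →ₗ[k] K k n :=
  (basisW k n).constr k fun I => (MvPolynomial.basisMonomials (Fin n) k).constr k fun m =>
    (basisW k n).constr k fun L => phiMonomial k I m L

/-- The bimodule map `φ : K ⊗_A K → K`,
`a ⊗ w ⊗ c ⊗ w' ⊗ a' ↦ a · φ(1 ⊗ w ⊗ c ⊗ w' ⊗ 1) · a'`. -/
def phi : KK k n →ₗ[k] K k n :=
  biact k n ∘ₗ LinearMap.lTensor (A k n)
    (TensorProduct.lift
      (TensorProduct.uncurry (RingHom.id k) (A k n) (W k n ⊗[k] A k n) (K k n ⊗[k] A k n) ∘ₗ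
        (phiGen k n).compr₂ (LinearMap.rTensorHom (A k n))))

/-! ### Cochains, the circle product and the bracket -/

/-- `Hom_{A^e}(K, A)`, as a subspace of `Hom_k(K, A)`. -/
def cochains : Submodule k (K k n →ₗ[k] A k n) where
  carrier := {f | (∀ a z, f (lact k n a z) = a * f z) ∧ ∀ a z, f (ract k n a z) = f z * a}
  add_mem' := fun hf hg => ⟨fun a z => by simp [hf.1, hg.1, mul_add],
    fun a z => by simp [hf.2, hg.2, add_mul]⟩
  zero_mem' := by simp
  smul_mem' := fun c f hf => ⟨fun a z => by simp [hf.1], fun a z => by simp [hf.2]⟩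

/-- The operator `w ↦ (-1)^{|w| q} w` on `W`. -/
def signW (q : ℕ) : W k n →ₗ[k] W k n :=
  (basisW k n).constr k fun I => (-1 : k) ^ (I.card * q) • o k I.sort

variable {k n}

/-- `g ⊗_A id_K : K ⊗_A K → A ⊗_A K = K`. -/
def tensorId (g : K k n →ₗ[k] A k n) : KK k n →ₗ[k] K k n :=
  TensorProduct.lift (lact k n) ∘ₗ
    LinearMap.rTensor (K k n)
      (g ∘ₗ LinearMap.lTensor (A k n) ((TensorProduct.mk k (W k n) (A k n)).flip 1)) ∘ₗ
    (TensorProduct.assoc k (A k n) (W k n) (K k n)).symm.toLinearMap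

/-- `id_K ⊗_A g ⊗_A id_K : K ⊗_A K ⊗_A K → K ⊗_A K` for `g` of degree `q`, with the Koszul sign:
`x ⊗ y ⊗ z ↦ (-1)^{|x| q} x ⊗ g(y) ⊗ z`. -/
def idTensorId (q : ℕ) (g : K k n →ₗ[k] A k n) : KKK k n →ₗ[k] KK k n :=
  LinearMap.lTensor (A k n) (TensorProduct.map (signW k n q) (tensorId g))

/-- The `φ`-circle product `f ∘_φ g = f φ (id_K ⊗_A g ⊗_A id_K) Δ_K^{(2)}`, `|g| = q`. -/
def circ (q : ℕ) (f g : K k n →ₗ[k] A k n) : K k n →ₗ[k] A k n :=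
  f ∘ₗ phi k n ∘ₗ idTensorId q g ∘ₗ comulK₂ k n

/-- The `φ`-bracket `[f, g]_φ = f ∘_φ g - (-1)^{(|f|-1)(|g|-1)} g ∘_φ f`, `|f| = p`, `|g| = q`. -/
def bracket (p q : ℕ) (f g : K k n →ₗ[k] A k n) : K k n →ₗ[k] A k n :=
  circ q f g - (Int.negOnePow (((p : ℤ) - 1) * ((q : ℤ) - 1)) : ℤ) • circ p g f

/-! ### Polyvector fields -/

variable (k n)

/-- `A[∂_1, …, ∂_n]`, the free graded commutative `A`-algebra on generators of degree `1`,
i.e. the exterior algebra of the free module `A^n`. -/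
abbrev Polyvector : Type _ := ExteriorAlgebra (A k n) (Fin n → A k n)

variable {n} in
/-- The generator `∂_i`. -/
def del (i : Fin n) : Polyvector k n := ExteriorAlgebra.ι (A k n) (Pi.single i 1)

variable {n} in
/-- `∂_I = ∂_{i_1} ⋯ ∂_{i_s}` for a finite sequence `I = (i_1, …, i_s)`. -/
def delList (I : List (Fin n)) : Polyvector k n := (I.map (del k)).prod

variable {n} in
/-- For `I = {i_1 < ⋯ < i_s}`, the `A`-linear form on polyvector fields with
`m_1 ⋯ m_s ↦ (-1)^{1+⋯+(s-1)} det((m_a)_{i_b})` for `m_1, …, m_s ∈ A^n`, zero outside degree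
`s`. -/
def polyvectorCoeff (I : Finset (Fin n)) : Polyvector k n →ₗ[A k n] A k n :=
  ExteriorAlgebra.liftAlternating fun s =>
    if h : I.card = s then
      (-1 : A k n) ^ (s * (s - 1) / 2) •
        (Matrix.detRowAlternating (n := Fin s) (R := A k n)).compLinearMap
          (LinearMap.funLeft (A k n) (A k n) (I.orderEmbOfFin h))
    else 0

/-- `Hom_k(W, A) → Hom_{A^e}(K, A)`, `h ↦ (a ⊗ w ⊗ a' ↦ a h(w) a')`. -/
def extendW : (W k n →ₗ[k] A k n) →ₗ[A k n] (K k n →ₗ[k] A k n) where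
  toFun h := LinearMap.mul' k (A k n) ∘ₗ LinearMap.lTensor (A k n)
    (LinearMap.mul' k (A k n) ∘ₗ LinearMap.rTensor (A k n) h)
  map_add' h₁ h₂ := by
    ext1
    refine LinearMap.ext fun a => TensorProduct.ext' fun w a' => ?_
    simp [mul_add]
  map_smul' c h := by
    refine TensorProduct.ext' fun a z => ?_
    induction z with
    | zero => simp
    | add x y hx hy => simp only [TensorProduct.tmul_add, map_add, hx, hy]
    | tmul w a' => simp [mul_assoc, mul_left_comm]

/-- The standard isomorphism `A[∂_1, …, ∂_n] → Hom_{A^e}(K, A)`: it sends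
`∂_I = ∂_{i_1} ⋯ ∂_{i_s}` to the function dual to `(-1)^{1+⋯+(s-1)} o(x_{i_1}, …, x_{i_s})`. -/
def toCochain : Polyvector k n →ₗ[A k n] (K k n →ₗ[k] A k n) :=
  extendW k n ∘ₗ ((basisW k n).constr (A k n)).toLinearMap ∘ₗ
    LinearMap.pi fun I => polyvectorCoeff k I

variable {k n}

/-- `β` is a Schouten–Nijenhuis bracket on `A[∂_1, …, ∂_n]`: the `k`-bilinear operation given by
the usual formulas on functions and vector fields and extended to all polyvector fields as a
graded antisymmetric graded biderivation (for the degree shifted by one). -/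
structure IsSchoutenNijenhuis
    (β : Polyvector k n →ₗ[k] Polyvector k n →ₗ[k] Polyvector k n) : Prop where
  fun_fun (a b : A k n) : β (algebraMap _ _ a) (algebraMap _ _ b) = 0
  vector_fun (a b : A k n) (i : Fin n) :
    β (a • del k i) (algebraMap _ _ b) = algebraMap _ _ (a * MvPolynomial.pderiv i b)
  vector_vector (a b : A k n) (i j : Fin n) :
    β (a • del k i) (b • del k j) =
      (a * MvPolynomial.pderiv i b) • del k j - (b * MvPolynomial.pderiv j a) • del k i
  antisymm (p q : ℕ) (ω η : Polyvector k n) (hω : ω ∈ ⋀[A k n]^p (Fin n → A k n))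
    (hη : η ∈ ⋀[A k n]^q (Fin n → A k n)) :
    β ω η = -((Int.negOnePow (((p : ℤ) - 1) * ((q : ℤ) - 1)) : ℤ) • β η ω)
  leibniz (p q : ℕ) (ω η ζ : Polyvector k n) (hω : ω ∈ ⋀[A k n]^p (Fin n → A k n))
    (hη : η ∈ ⋀[A k n]^q (Fin n → A k n)) :
    β ω (η * ζ) = β ω η * ζ + (Int.negOnePow (((p : ℤ) - 1) * (q : ℤ)) : ℤ) • (η * β ω ζ)

end KoszulPoly

end

open scoped TensorProduct DirectSum

noncomputable section

namespace KoszulPoly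

/-! ### Word coefficients on the tensor coalgebra and on `W` -/

variable (k : Type*) [Field k] {n : ℕ}

/-! Everything is computed by duality. The functional reading off the coefficient of a word on `TA`
turns deconcatenation into concatenation (`tensorForm_coeffList_comulTA`). Its restriction `coeffW
l` to `W` is, for increasing `l`, a member of the basis dual to the `o(x_I)`; for every word `l` the
cochain of `a ∂_l` is `a · coeffW l` up to the sign `(-1)^{1+⋯+(s-1)}`. The coproduct of `W`
therefore never has to be written as a sum over shuffles. The differential dies on cochains because
`A` is commutative, so left and right multiplication by `x_i` cancel.

For increasing `I`, composing such a cochain with `φ` gives a Leibniz rule (`extendW_phiMonomial`):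
`φ` removes one letter at a time from an ordered monomial, and `coeffW I` keeps exactly the terms
with `I = L, j, S`, so what remains is the sum over positions `r` of `I` of `∂/∂x_{i_r}` on the
middle factor, times the coefficients of the tail and head of `I`. Inserting `b ∂_J` between them
yields the words (tail, `J`, head), and graded commutativity rotates these into (head, `J`, tail).

The result is the coordinate-free operation `circPoly`, built from contractions with `dx_i` and
derivatives of coefficients. Since it is biadditive and increasing words span, the formula for
increasing `I` implies the one for arbitrary sequences (`circ_toCochain`). Its antisymmetrisation
`schouten` satisfies the Leibniz rule because contraction is an antiderivation and `coeffDeriv` a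
derivation; antisymmetry and Leibniz reduce uniqueness to functions and vector fields. -/

/-- The coefficient of `x_{l_1} ⊗ ⋯ ⊗ x_{l_s}` in an element of `TA`, for a sequence `l`. -/
def coeffList (l : List (Fin n)) : TA k n →ₗ[k] k :=
  DirectSum.toModule k ℕ _ fun r =>
    if h : l.length = r then
      PiTensorProduct.lift ((MultilinearMap.mkPiAlgebra k (Fin r) k).compLinearMap
        fun j => MvPolynomial.lcoeff k (Finsupp.single (l.get (j.cast h.symm)) 1))
    else 0

theorem coeffList_lof_tprod (l : List (Fin n)) (r : ℕ) (v : Fin r → A k n) :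
    coeffList k l (DirectSum.lof k ℕ (fun r => ⨂[k]^r (A k n)) r (PiTensorProduct.tprod k v)) =
      if l.length = r then
        (List.zipWith (fun i a => MvPolynomial.coeff (Finsupp.single i 1) a) l
          (List.ofFn v)).prod
      else 0 := by
  rw [coeffList, DirectSum.toModule_lof]
  split_ifs with h
  · subst h
    rw [PiTensorProduct.lift.tprod, MultilinearMap.compLinearMap_apply,
      MultilinearMap.mkPiAlgebra_apply, ← List.prod_ofFn]
    congr 1
    refine List.ext_getElem (by simp) fun i h₁ h₂ => ?_
    simp [MvPolynomial.lcoeff]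
  · rfl

theorem coeffList_lof_of_ne {l : List (Fin n)} {r : ℕ} (h : l.length ≠ r) (t : ⨂[k]^r (A k n)) :
    coeffList k l (DirectSum.lof k ℕ (fun r => ⨂[k]^r (A k n)) r t) = 0 := by
  rw [coeffList, DirectSum.toModule_lof, dif_neg h, LinearMap.zero_apply]

theorem splitAt_tprod {i j : ℕ} (v : Fin i → A k n) (w : Fin j → A k n) :
    splitAt k n rfl (PiTensorProduct.tprod k (Fin.append v w)) =
      PiTensorProduct.tprod k v ⊗ₜ[k] PiTensorProduct.tprod k w := by
  rw [splitAt, TensorPower.cast_refl]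
  simp only [LinearMap.comp_apply, LinearEquiv.coe_coe, LinearEquiv.refl_apply]
  rw [LinearEquiv.symm_apply_eq, ← TensorPower.gMul_def, TensorPower.tprod_mul_tprod]

/-- The product of two linear forms, as a linear form on the tensor product. -/
abbrev tensorForm {M N : Type*} [AddCommMonoid M] [Module k M] [AddCommMonoid N] [Module k N]
    (α : M →ₗ[k] k) (β : N →ₗ[k] k) : M ⊗[k] N →ₗ[k] k :=
  LinearMap.mul' k k ∘ₗ TensorProduct.map α β

/-- On a decomposable tensor both sides are products of letter coefficients. Only the cut at
position `|l|` can contribute, so a single summand of the coproduct survives. -/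
theorem tensorForm_coeffList_splitAt (l l' : List (Fin n)) {r i j : ℕ} (h : r = i + j)
    (t : ⨂[k]^r (A k n)) :
    tensorForm k (coeffList k l) (coeffList k l')
      (TensorProduct.map (DirectSum.lof k ℕ (fun r => ⨂[k]^r (A k n)) i)
        (DirectSum.lof k ℕ (fun r => ⨂[k]^r (A k n)) j) (splitAt k n h t)) =
      if l.length = i then
        coeffList k (l ++ l') (DirectSum.lof k ℕ (fun r => ⨂[k]^r (A k n)) r t)
      else 0 := by
  subst h
  induction t using PiTensorProduct.induction_on with
  | add x y hx hy =>
    simp only [map_add, hx, hy]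
    split_ifs <;> simp
  | smul_tprod c v =>
    simp only [map_smul]
    obtain ⟨v, w, rfl⟩ : ∃ (v' : Fin i → A k n) (w : Fin j → A k n), v = Fin.append v' w :=
      ⟨fun s => v (Fin.castAdd j s), fun s => v (Fin.natAdd i s),
        (Fin.append_castAdd_natAdd (f := v)).symm⟩
    rw [splitAt_tprod, TensorProduct.map_tmul, LinearMap.comp_apply, TensorProduct.map_tmul,
      LinearMap.mul'_apply]
    simp only [coeffList_lof_tprod]
    by_cases h₁ : l.length = i
    · rw [if_pos h₁, if_pos h₁]
      by_cases h₂ : l'.length = j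
      · rw [if_pos h₂, if_pos (by simp [h₁, h₂]), List.ofFn_fin_append,
          List.zipWith_append (by simp [h₁]), List.prod_append]
      · rw [if_neg h₂, if_neg (by simp [h₁, h₂]), mul_zero]
    · rw [if_neg h₁, if_neg h₁, zero_mul, smul_zero]

/-- Concatenation of sequences is dual to deconcatenation. -/
theorem tensorForm_coeffList_comulTA (l l' : List (Fin n)) (t : TA k n) :
    tensorForm k (coeffList k l) (coeffList k l') (comulTA k n t) = coeffList k (l ++ l') t := by
  suffices h : tensorForm k (coeffList k l) (coeffList k l') ∘ₗ comulTA k n =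
      coeffList k (l ++ l') from LinearMap.congr_fun h t
  refine DirectSum.linearMap_ext k fun r => LinearMap.ext fun t => ?_
  simp only [LinearMap.comp_apply]
  rw [comulTA, DirectSum.toModule_lof, LinearMap.sum_apply, map_sum, map_sum]
  simp only [LinearMap.comp_apply (TensorProduct.map _ _) (splitAt _ _ _)]
  have key := fun i : Fin (r + 1) => tensorForm_coeffList_splitAt k l l'
    (show r = (i : ℕ) + (r - i) by have := i.2; omega) t
  simp only [LinearMap.comp_apply] at key
  simp only [key]
  by_cases hl : l.length < r + 1
  · rw [Finset.sum_eq_single ⟨l.length, hl⟩]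
    · simp
    · intro i _ hi
      rw [if_neg fun e => hi (Fin.ext e.symm)]
    · simp
  -- Here `l` alone is longer than the tensor degree: no cut matches, and the concatenated word is
  -- too long as well.
  · rw [coeffList_lof_of_ne k (by rw [List.length_append]; omega), Finset.sum_eq_zero]
    intro i _
    rw [if_neg (by have := i.2; omega)]

/-- The restriction of `coeffList` to `W`. -/
def coeffW (l : List (Fin n)) : W k n →ₗ[k] k := coeffList k l ∘ₗ (W k n).subtype

theorem map_subtype_comulW (w : W k n) :
    TensorProduct.map (W k n).subtype (W k n).subtype (comulW k n w) = comulTA k n w := by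
  have h := LinearEquiv.apply_symm_apply
    (LinearEquiv.ofInjective _ (map_subtype_injective k n))
    ((comulTA k n ∘ₗ (W k n).subtype).codRestrict _ (comulTA_mem k n) w)
  exact congrArg Subtype.val h

/-- The coproduct of `W` is known only through its image in `TA ⊗ TA`, which is all that word
coefficients see. -/
theorem tensorForm_coeffW_comulW (l l' : List (Fin n)) (w : W k n) :
    tensorForm k (coeffW k l) (coeffW k l') (comulW k n w) = coeffW k (l ++ l') w := by
  rw [coeffW, coeffW, coeffW, tensorForm, TensorProduct.map_comp, LinearMap.comp_apply,
    LinearMap.comp_apply, map_subtype_comulW, LinearMap.comp_apply,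
    ← tensorForm_coeffList_comulTA]
  rfl

theorem coeffList_sort (I : Finset (Fin n)) : coeffList k I.sort = coeffTA k n I := by
  refine DirectSum.linearMap_ext k fun r => ?_
  rw [coeffList, coeffTA]
  ext v
  simp only [LinearMap.compMultilinearMap_apply, LinearMap.comp_apply, DirectSum.toModule_lof]
  by_cases h : I.card = r
  · rw [dif_pos (by simpa using h), dif_pos h]
    subst h
    simp only [PiTensorProduct.lift.tprod, MultilinearMap.compLinearMap_apply]
    rfl
  · rw [dif_neg (by simpa using h), dif_neg h]

theorem coeffW_o_sort (I J : Finset (Fin n)) :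
    coeffW k I.sort (o k J.sort) = if I = J then 1 else 0 := by
  rw [coeffW, LinearMap.comp_apply, coeffList_sort, ← coeffTA_o]
  rfl

theorem eq_sort_of_sortedLT {l : List (Fin n)} (h : l.SortedLT) : l.toFinset.sort = l :=
  (List.toFinset_sort (· ≤ ·) h.nodup).2 h.sortedLE.pairwise

theorem coeffW_o_of_sortedLT {l l' : List (Fin n)} (h : l.SortedLT) (h' : l'.SortedLT) :
    coeffW k l (o k l') = if l = l' then 1 else 0 := by
  rw [← eq_sort_of_sortedLT h, ← eq_sort_of_sortedLT h', coeffW_o_sort]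
  refine if_congr ⟨fun e => by rw [e], fun e => ?_⟩ rfl rfl
  rw [← Finset.sort_toFinset l.toFinset (· ≤ ·), e, Finset.sort_toFinset]

theorem basisW_apply (I : Finset (Fin n)) : basisW k n I = o k I.sort := by
  rw [basisW, Module.Basis.mk_apply]

theorem coeffW_o_of_length_ne {l l' : List (Fin n)} (h : l.length ≠ l'.length) :
    coeffW k l (o k l') = 0 :=
  coeffList_lof_of_ne k h _

/-- `coeffW l` sees only the component of degree `|l|`, on which `signW` is a scalar. -/
theorem coeffW_signW (q : ℕ) (l : List (Fin n)) (w : W k n) :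
    coeffW k l (signW k n q w) = (-1) ^ (l.length * q) * coeffW k l w := by
  suffices h : coeffW k l ∘ₗ signW k n q = (-1 : k) ^ (l.length * q) • coeffW k l by
    simpa using LinearMap.congr_fun h w
  refine (basisW k n).ext fun I => ?_
  rw [LinearMap.comp_apply, signW, Module.Basis.constr_basis, LinearMap.smul_apply,
    basisW_apply, map_smul]
  by_cases h : l.length = I.card
  · rw [h]
  · rw [coeffW_o_of_length_ne k (by simpa using h), smul_zero, smul_zero]

/-! ### Coordinates of `∂_l` -/

theorem delList_eq_ιMulti (l : List (Fin n)) : delList k l =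
    ExteriorAlgebra.ιMulti (A k n) l.length fun j => Pi.single (l.get j) 1 := by
  rw [ExteriorAlgebra.ιMulti_apply, delList]
  congr 1
  refine List.ext_getElem (by simp) fun i h₁ h₂ => ?_
  simp [del]

/-- The coordinates of `∂_l` are, up to the sign `(-1)^{1+⋯+(s-1)}`, given by `coeffW`. -/
theorem polyvectorCoeff_delList (I : Finset (Fin n)) (l : List (Fin n)) :
    polyvectorCoeff k I (delList k l) =
      (-1) ^ (l.length * (l.length - 1) / 2) * MvPolynomial.C (coeffW k l (o k I.sort)) := by
  rw [delList_eq_ιMulti, polyvectorCoeff, ExteriorAlgebra.liftAlternating_apply_ιMulti]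
  split_ifs with h
  · rw [AlternatingMap.smul_apply, smul_eq_mul, AlternatingMap.compLinearMap_apply]
    congr 1
    -- The orbit sum is the Leibniz expansion of a determinant of Kronecker deltas, the transpose of
    -- the one defining `polyvectorCoeff`. This allows unsorted words and repeated letters.
    have ho : coeffW k l (o k I.sort) = (Matrix.of fun i j : Fin l.length =>
        if I.orderEmbOfFin h i = l.get j then (1 : k) else 0).det := by
      rw [coeffW, LinearMap.comp_apply, Submodule.subtype_apply, o_sort_coe k n I h, orbitSum,
        MultilinearMap.alternatization_apply, map_sum, map_sum, Matrix.det_apply]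
      refine Finset.sum_congr rfl fun σ _ => ?_
      rw [map_zsmul_unit, map_zsmul_unit, MultilinearMap.domDomCongr_apply, coeffList_lof_tprod,
        if_pos rfl, ← List.prod_ofFn]
      congr 2
      refine List.ext_getElem (by simp) fun i h₁ h₂ => ?_
      simp [MvPolynomial.coeff_X, Finsupp.single_left_inj]
    rw [ho, ← Matrix.det_transpose, RingHom.map_det]
    refine congrArg Matrix.det (Matrix.ext fun i j => ?_)
    simp [Pi.single_apply, Matrix.transpose_apply, apply_ite, LinearMap.funLeft_apply]
  · rw [coeffW_o_of_length_ne k (by simpa [eq_comm] using h)]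
    simp

/-! ### Cochains -/

theorem lact_tmul (b a : A k n) (y : W k n ⊗[k] A k n) :
    lact k n b (a ⊗ₜ y) = (b * a) ⊗ₜ y := rfl

theorem ract_tmul (b a a' : A k n) (w : W k n) :
    ract k n b (a ⊗ₜ (w ⊗ₜ a')) = a ⊗ₜ (w ⊗ₜ (a' * b)) := rfl

theorem extendW_tmul (h : W k n →ₗ[k] A k n) (a a' : A k n) (w : W k n) :
    extendW k n h (a ⊗ₜ (w ⊗ₜ a')) = a * (h w * a') := rfl

variable {k} in
theorem K_hom_ext {f g : K k n →ₗ[k] A k n}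
    (h : ∀ a w a', f (a ⊗ₜ (w ⊗ₜ a')) = g (a ⊗ₜ (w ⊗ₜ a'))) : f = g := by
  refine TensorProduct.ext' fun a y => ?_
  induction y with
  | zero => simp
  | add x y hx hy => simp only [TensorProduct.tmul_add, map_add, hx, hy]
  | tmul w a' => exact h a w a'

theorem extendW_mem_cochains (h : W k n →ₗ[k] A k n) : extendW k n h ∈ cochains k n := by
  constructor
  · intro a z
    suffices e : extendW k n h ∘ₗ lact k n a = LinearMap.mulLeft k a ∘ₗ extendW k n h from
      LinearMap.congr_fun e z
    refine K_hom_ext fun b w b' => ?_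
    simp only [LinearMap.comp_apply, lact_tmul, extendW_tmul, LinearMap.mulLeft_apply, mul_assoc]
  · intro a z
    suffices e : extendW k n h ∘ₗ ract k n a = LinearMap.mulRight k a ∘ₗ extendW k n h from
      LinearMap.congr_fun e z
    refine K_hom_ext fun b w b' => ?_
    simp only [LinearMap.comp_apply, ract_tmul, extendW_tmul, LinearMap.mulRight_apply, mul_assoc]

variable {k} in
theorem cochains_apply_tmul {f : K k n →ₗ[k] A k n} (hf : f ∈ cochains k n) (a a' : A k n)
    (w : W k n) : f (a ⊗ₜ (w ⊗ₜ a')) = a * (f (1 ⊗ₜ (w ⊗ₜ 1)) * a') := by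
  rw [← hf.2, ← hf.1, ract_tmul, lact_tmul, mul_one, one_mul]

theorem range_extendW : Set.range (extendW k n) = cochains k n := by
  refine Set.Subset.antisymm ?_ fun f hf => ?_
  · rintro _ ⟨h, rfl⟩
    exact extendW_mem_cochains k h
  · refine ⟨f ∘ₗ TensorProduct.mk k _ _ 1 ∘ₗ (TensorProduct.mk k _ _).flip 1, ?_⟩
    refine K_hom_ext fun a w a' => ?_
    rw [extendW_tmul, cochains_apply_tmul hf]
    rfl

theorem extendW_injective : Function.Injective (extendW k n) := by
  intro h h' e
  refine LinearMap.ext fun w => ?_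
  have := LinearMap.congr_fun e (1 ⊗ₜ (w ⊗ₜ 1))
  simpa only [extendW_tmul, one_mul, mul_one] using this

theorem biact_tmul (a a' : A k n) (z : K k n) :
    biact k n (a ⊗ₜ (z ⊗ₜ a')) = lact k n a (ract k n a' z) := rfl

/-- Commutativity of `A` equates the two actions on values of `f`; every term of the Koszul
differential has this shape. -/
theorem map_tmul_sub_tmul {f : K k n →ₗ[k] A k n} (hf : f ∈ cochains k n) (a : A k n)
    (w : W k n) : f (a ⊗ₜ (w ⊗ₜ 1) - 1 ⊗ₜ (w ⊗ₜ a)) = 0 := by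
  rw [map_sub, cochains_apply_tmul hf a, cochains_apply_tmul hf 1 a, mul_one, one_mul, mul_comm,
    sub_self]

/-- The differential of `Hom_{A^e}(K, A)` vanishes. -/
theorem cochains_comp_koszulD {f : K k n →ₗ[k] A k n} (hf : f ∈ cochains k n) :
    f ∘ₗ koszulD k n = 0 := by
  refine K_hom_ext fun a w a' => ?_
  rw [koszulD, LinearMap.comp_apply, LinearMap.comp_apply, LinearMap.lTensor_tmul,
    LinearMap.rTensor_tmul, biact_tmul, hf.1, hf.2, LinearMap.zero_apply]
  rw [← LinearMap.comp_apply f]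
  suffices e : ∀ c : Finset (Fin n) → K k n, (∀ I, f (c I) = 0) →
      f ∘ₗ (basisW k n).constr k c = 0 by
    rw [e, LinearMap.zero_apply, zero_mul, mul_zero]
    intro I
    rw [map_sum]
    refine Finset.sum_eq_zero fun l _ => ?_
    rw [map_smul, map_tmul_sub_tmul k hf, smul_zero]
  intro c hc
  refine (basisW k n).ext fun I => ?_
  rw [LinearMap.comp_apply, Module.Basis.constr_basis, hc, LinearMap.zero_apply]

theorem toCochain_smul_delList (a : A k n) (l : List (Fin n)) :
    toCochain k n (a • delList k l) = extendW k n
      (((-1) ^ (l.length * (l.length - 1) / 2) * a) •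
        Algebra.linearMap k (A k n) ∘ₗ coeffW k l) := by
  rw [toCochain, LinearMap.comp_apply]
  congr 1
  refine (basisW k n).ext fun I => ?_
  rw [LinearMap.comp_apply, LinearEquiv.coe_coe, Module.Basis.constr_basis, LinearMap.pi_apply,
    map_smul, polyvectorCoeff_delList, LinearMap.smul_apply, LinearMap.comp_apply, basisW_apply,
    smul_eq_mul, smul_eq_mul, Algebra.linearMap_apply, MvPolynomial.algebraMap_eq]
  ring

theorem toCochain_smul_delList_tmul (a b b' : A k n) (l : List (Fin n)) (w : W k n) :
    toCochain k n (a • delList k l) (b ⊗ₜ (w ⊗ₜ b')) =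
      b * ((-1) ^ (l.length * (l.length - 1) / 2) * a * MvPolynomial.C (coeffW k l w) * b') := by
  rw [toCochain_smul_delList, extendW_tmul]
  rfl

/-! ### The map `φ` -/

/-- The Leibniz rule in the form matching `φ`: each occurrence of `x_i` is deleted in turn, leaving
the letters before and after it. -/
theorem pderiv_prod_map_X (i : Fin n) (l : List (Fin n)) :
    MvPolynomial.pderiv i ((l.map MvPolynomial.X).prod : A k n) =
      ∑ ν : Fin l.length, if l[ν]'ν.2 = i then
        ((l.take ν).map MvPolynomial.X).prod * ((l.drop (ν + 1)).map MvPolynomial.X).prod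
      else 0 := by
  induction l with
  | nil => simp
  | cons j l ih =>
    rw [List.map_cons, List.prod_cons, Derivation.leibniz, ih, smul_eq_mul, smul_eq_mul,
      add_comm]
    simp only [List.length_cons]
    rw [Fin.sum_univ_succ, Finset.mul_sum, MvPolynomial.pderiv_X]
    congr 1
    · simp [Pi.single_apply]
    · refine Finset.sum_congr rfl fun ν _ => ?_
      simp [mul_assoc]

theorem prod_map_X_sort (m : Fin n →₀ ℕ) :
    (((Finsupp.toMultiset m).sort.map MvPolynomial.X).prod : A k n) =
      MvPolynomial.monomial m 1 := by
  rw [← Multiset.prod_coe, ← Multiset.map_coe, Multiset.sort_eq, Finsupp.toMultiset_map,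
    Finsupp.prod_toMultiset, MvPolynomial.monomial_eq, map_one, one_mul]
  exact Finsupp.prod_mapDomain_index (fun _ => pow_zero _) fun _ _ _ => pow_add _ _ _

theorem eq_append_cons_iff {I L S : List (Fin n)} {j : Fin n} :
    (I = L ++ j :: S) ↔
      ∃ r : Fin I.length, I.take r = L ∧ I[r]'r.2 = j ∧ I.drop (r + 1) = S := by
  constructor
  · rintro rfl
    exact ⟨⟨L.length, by simp⟩, by simp⟩
  · rintro ⟨r, rfl, rfl, rfl⟩
    simp

/-- The summation condition in `φ` says exactly that the orbit sum it produces is a basis element of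
`W`. -/
theorem sortedLT_sort_append_cons_sort {L S : Finset (Fin n)} {j : Fin n} :
    (L.sort ++ j :: S.sort).SortedLT ↔ (∀ l ∈ L, l < j) ∧ ∀ i ∈ S, j < i := by
  rw [List.sortedLT_iff_pairwise, List.pairwise_append, List.pairwise_cons]
  have hL : L.sort.Pairwise (· < ·) := (Finset.sortedLT_sort L).pairwise
  have hS : S.sort.Pairwise (· < ·) := (Finset.sortedLT_sort S).pairwise
  simp only [hL, hS, true_and, and_true, List.mem_cons, Finset.mem_sort]
  constructor
  · rintro ⟨h₁, h₂⟩
    exact ⟨fun l hl => h₂ l hl j (Or.inl rfl), h₁⟩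
  · rintro ⟨h₁, h₂⟩
    refine ⟨h₂, fun l hl i hi => ?_⟩
    rcases hi with rfl | hi
    · exact h₁ l hl
    · exact (h₁ l hl).trans (h₂ i hi)

/-- A letter `j` of the monomial contributes on the left only if `I` is `L`, `j`, `S` concatenated.
On the right this is the condition that some position `r` of `I` has head `L`, letter `j` and tail
`S`. Increasing `I` makes the coefficients involved Kronecker deltas. -/
theorem extendW_phiMonomial {I : List (Fin n)} (hI : I.SortedLT) (a : A k n)
    (S : Finset (Fin n)) (m : Fin n →₀ ℕ) (L : Finset (Fin n)) :
    extendW k n (a • Algebra.linearMap k (A k n) ∘ₗ coeffW k I) (phiMonomial k S m L) =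
      ∑ r : Fin I.length, (-1) ^ ((I.drop (r + 1)).length * r + r) * a *
        MvPolynomial.pderiv (I[r]'r.2) (MvPolynomial.monomial m 1) *
        MvPolynomial.C (coeffW k (I.drop (r + 1)) (o k S.sort)) *
        MvPolynomial.C (coeffW k (I.take r) (o k L.sort)) := by
  have hdrop : ∀ r, (I.drop r).SortedLT := fun r => (hI.pairwise.drop).sortedLT
  have htake : ∀ r, (I.take r).SortedLT := fun r => (hI.pairwise.take).sortedLT
  simp only [phiMonomial]
  rw [← prod_map_X_sort]
  set j := (Finsupp.toMultiset m).sort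
  simp only [pderiv_prod_map_X, coeffW_o_of_sortedLT k (hdrop _) (Finset.sortedLT_sort S),
    coeffW_o_of_sortedLT k (htake _) (Finset.sortedLT_sort L), Finset.mul_sum, Finset.sum_mul]
  rw [Finset.sum_comm, map_sum]
  refine Finset.sum_congr rfl fun ν _ => ?_
  by_cases h : I = L.sort ++ j[ν]'ν.2 :: S.sort
  · obtain ⟨r, hr₁, hr₂, hr₃⟩ := eq_append_cons_iff.1 h
    -- The head has length `r`, so at most one position contributes to each letter.
    have hlen : (r : ℕ) = L.card := by
      rw [← Finset.length_sort (· ≤ ·), ← hr₁, List.length_take, min_eq_left r.2.le]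
    rw [if_pos (sortedLT_sort_append_cons_sort.1 (h ▸ hI)), Finset.sum_eq_single r]
    · rw [map_smul, extendW_tmul, ← h, LinearMap.smul_apply, LinearMap.comp_apply,
        coeffW_o_of_sortedLT k hI hI, if_pos rfl, if_pos hr₂.symm, if_pos hr₃, if_pos hr₁, hr₃,
        Finset.length_sort, hlen]
      simp only [map_one, Algebra.linearMap_apply, smul_eq_mul, mul_one,
        MvPolynomial.smul_eq_C_mul, map_pow, map_neg]
      ring
    · intro r' _ hne
      suffices h' : I.take r' ≠ L.sort by rw [if_neg h', map_zero, mul_zero]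
      intro h'
      refine hne (Fin.ext ?_)
      rw [hlen, ← Finset.length_sort (· ≤ ·), ← h', List.length_take, min_eq_left r'.2.le]
    · simp
  · rw [Finset.sum_eq_zero]
    -- Either `φ` omits this letter, or it produces an increasing word other than `I`, which the
    -- dual basis element kills.
    · split_ifs with hc
      · rw [map_smul, extendW_tmul, LinearMap.smul_apply, LinearMap.comp_apply,
          coeffW_o_of_sortedLT k hI (sortedLT_sort_append_cons_sort.2 hc), if_neg h]
        simp
      · exact map_zero _
    · intro r _
      by_cases h₁ : I.take r = L.sort
      · by_cases h₂ : j[ν]'ν.2 = I[r]'r.2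
        · suffices h' : I.drop (r + 1) ≠ S.sort by
            rw [if_neg h', map_zero, mul_zero, zero_mul]
          exact fun h₃ => h (eq_append_cons_iff.2 ⟨r, h₁, h₂.symm, h₃⟩)
        · rw [if_neg h₂, mul_zero, zero_mul, zero_mul]
      · rw [if_neg h₁, map_zero, mul_zero]

theorem basis_induction {ι R M : Type*} [Semiring R] [AddCommMonoid M] [Module R M]
    (b : Module.Basis ι R M) {P : M → Prop} (basis : ∀ i, P (b i)) (zero : P 0)
    (add : ∀ x y, P x → P y → P (x + y)) (smul : ∀ (c : R) x, P x → P (c • x)) (x : M) : P x :=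
  Submodule.span_induction (p := fun x _ => P x) (by rintro _ ⟨i, rfl⟩; exact basis i) zero
    (fun x y _ _ => add x y) (fun c x _ => smul c x) (b.mem_span x)

theorem extendW_phiGen {I : List (Fin n)} (hI : I.SortedLT) (a c : A k n) (w w' : W k n) :
    extendW k n (a • Algebra.linearMap k (A k n) ∘ₗ coeffW k I) (phiGen k n w c w') =
      ∑ r : Fin I.length, (-1) ^ ((I.drop (r + 1)).length * r + r) * a *
        MvPolynomial.pderiv (I[r]'r.2) c *
        MvPolynomial.C (coeffW k (I.drop (r + 1)) w) *
        MvPolynomial.C (coeffW k (I.take r) w') := by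
  -- Only linearity of the cochain matters until all three arguments are basis elements.
  generalize hf : extendW k n (a • Algebra.linearMap k (A k n) ∘ₗ coeffW k I) = f
  induction w using basis_induction (basisW k n) with
  | zero => simp
  | add x y hx hy =>
    simp only [map_add, LinearMap.add_apply, hx, hy, add_mul, mul_add, Finset.sum_add_distrib]
  | smul t x hx =>
    simp only [map_smul, LinearMap.smul_apply, hx, Finset.smul_sum, smul_eq_mul, map_mul]
    exact Finset.sum_congr rfl fun r _ => by rw [MvPolynomial.smul_eq_C_mul]; ring
  | basis S =>
  induction w' using basis_induction (basisW k n) with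
  | zero => simp
  | add x y hx hy =>
    simp only [map_add, hx, hy, mul_add, Finset.sum_add_distrib]
  | smul t x hx =>
    simp only [map_smul, hx, Finset.smul_sum, smul_eq_mul, map_mul]
    exact Finset.sum_congr rfl fun r _ => by rw [MvPolynomial.smul_eq_C_mul]; ring
  | basis L =>
  induction c using basis_induction (MvPolynomial.basisMonomials (Fin n) k) with
  | zero => simp
  | add x y hx hy =>
    simp only [map_add, LinearMap.add_apply, hx, hy, add_mul, mul_add, Finset.sum_add_distrib]
  | smul t x hx =>
    simp only [map_smul, LinearMap.smul_apply, hx, Finset.smul_sum]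
    refine Finset.sum_congr rfl fun r _ => ?_
    rw [Derivation.map_smul, MvPolynomial.smul_eq_C_mul, MvPolynomial.smul_eq_C_mul]
    ring
  | basis m =>
  rw [← hf, phiGen, Module.Basis.constr_basis, Module.Basis.constr_basis, Module.Basis.constr_basis,
    extendW_phiMonomial k hI, basisW_apply, basisW_apply, MvPolynomial.coe_basisMonomials]

/-! ### The circle product -/

theorem phi_tmul (a c a' : A k n) (w w' : W k n) :
    phi k n (a ⊗ₜ (w ⊗ₜ (c ⊗ₜ (w' ⊗ₜ a')))) =
      lact k n a (ract k n a' (phiGen k n w c w')) := rfl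

theorem idTensorId_tmul (q : ℕ) (g : K k n →ₗ[k] A k n) (a a' : A k n) (w₁ w₂ w₃ : W k n) :
    idTensorId q g (a ⊗ₜ (w₁ ⊗ₜ (1 ⊗ₜ (w₂ ⊗ₜ (1 ⊗ₜ (w₃ ⊗ₜ a')))))) =
      a ⊗ₜ (signW k n q w₁ ⊗ₜ (g (1 ⊗ₜ (w₂ ⊗ₜ 1)) ⊗ₜ (w₃ ⊗ₜ a'))) := by
  -- The trailing `* 1` is the action of the value of `g` on the unit in the following copy of `A`.
  have : idTensorId q g (a ⊗ₜ (w₁ ⊗ₜ (1 ⊗ₜ (w₂ ⊗ₜ (1 ⊗ₜ (w₃ ⊗ₜ a')))))) =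
      a ⊗ₜ (signW k n q w₁ ⊗ₜ ((g (1 ⊗ₜ (w₂ ⊗ₜ 1)) * 1) ⊗ₜ (w₃ ⊗ₜ a'))) := rfl
  rw [this, mul_one]

/-- If `f φ` is a sum of products of word coefficients in its outer `W`-factors, then `f ∘_φ g`
reads the iterated coproduct through three words, that is, through their concatenation. The sign in
`q` is the Koszul sign of `g` passing the first factor. -/
theorem circ_apply_tmul {ι : Type*} [Fintype ι] (q : ℕ) {f : K k n →ₗ[k] A k n}
    (hf : f ∈ cochains k n) (u : ι → A k n) (δ : ι → A k n →ₗ[k] A k n)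
    (l l' : ι → List (Fin n))
    (hφ : ∀ w c w', f (phiGen k n w c w') = ∑ r, u r * δ r c *
      MvPolynomial.C (coeffW k (l r) w) * MvPolynomial.C (coeffW k (l' r) w'))
    (b : A k n) (J : List (Fin n)) (a a' : A k n) (w : W k n) :
    circ q f (extendW k n (b • Algebra.linearMap k (A k n) ∘ₗ coeffW k J)) (a ⊗ₜ (w ⊗ₜ a')) =
      ∑ r, a * ((-1) ^ ((l r).length * q) * u r * δ r b *
        MvPolynomial.C (coeffW k (l r ++ J ++ l' r) w) * a') := by
  set g := extendW k n (b • Algebra.linearMap k (A k n) ∘ₗ coeffW k J) with hg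
  have h₁ : ∀ w₁ w₂ w₃ : W k n, f (phi k n (idTensorId q g
      (a ⊗ₜ (w₁ ⊗ₜ (1 ⊗ₜ (w₂ ⊗ₜ (1 ⊗ₜ (w₃ ⊗ₜ a')))))))) =
      ∑ r, a * ((-1) ^ ((l r).length * q) * u r * δ r b *
        MvPolynomial.C (coeffW k (l r) w₁ * coeffW k J w₂ * coeffW k (l' r) w₃) * a') := by
    intro w₁ w₂ w₃
    rw [idTensorId_tmul, phi_tmul, hf.1, hf.2, hφ, Finset.sum_mul, Finset.mul_sum]
    refine Finset.sum_congr rfl fun r _ => ?_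
    have : g (1 ⊗ₜ (w₂ ⊗ₜ 1)) = coeffW k J w₂ • b := by
      rw [hg, extendW_tmul, one_mul, mul_one, MvPolynomial.smul_eq_C_mul, mul_comm]
      rfl
    rw [this, map_smul, coeffW_signW, MvPolynomial.smul_eq_C_mul]
    simp only [map_mul, map_pow, map_neg, map_one]
    ring
  -- A coproduct is not a pure tensor, so it is replaced by an arbitrary `z`; `h₂` treats the inner
  -- coproduct and `h₃` the outer one.
  have h₂ : ∀ (z : W k n ⊗[k] W k n) (w₃ : W k n), f (phi k n (idTensorId q g
      (a ⊗ₜ (LinearMap.lTensor (W k n) (TensorProduct.mk k (A k n) (W k n ⊗[k] K k n) 1)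
        (TensorProduct.assoc k (W k n) (W k n) (K k n) (z ⊗ₜ (1 ⊗ₜ (w₃ ⊗ₜ a')))))))) =
      ∑ r, a * ((-1) ^ ((l r).length * q) * u r * δ r b *
        MvPolynomial.C (tensorForm k (coeffW k (l r)) (coeffW k J) z *
          coeffW k (l' r) w₃) * a') := by
    intro z w₃
    induction z with
    | zero => simp
    | add x y hx hy =>
      simp only [TensorProduct.tmul_add, TensorProduct.add_tmul, map_add, hx, hy, add_mul,
        mul_add, Finset.sum_add_distrib]
    | tmul w₁ w₂ => exact h₁ w₁ w₂ w₃
  have h₃ : ∀ z : W k n ⊗[k] W k n, f (phi k n (idTensorId q g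
      (comulTensor k n (K k n) (a ⊗ₜ (LinearMap.lTensor (W k n)
        (TensorProduct.mk k (A k n) (W k n ⊗[k] A k n) 1)
        (TensorProduct.assoc k (W k n) (W k n) (A k n) (z ⊗ₜ a'))))))) =
      ∑ r, a * ((-1) ^ ((l r).length * q) * u r * δ r b *
        MvPolynomial.C (tensorForm k (coeffW k (l r ++ J)) (coeffW k (l' r)) z) * a') := by
    intro z
    induction z with
    | zero => simp
    | add x y hx hy =>
      simp only [TensorProduct.tmul_add, TensorProduct.add_tmul, map_add, hx, hy, add_mul,
        mul_add, Finset.sum_add_distrib]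
    | tmul w₁ w₃ =>
      refine (h₂ (comulW k n w₁) w₃).trans (Finset.sum_congr rfl fun r _ => ?_)
      rw [tensorForm_coeffW_comulW]
      rfl
  refine (h₃ (comulW k n w)).trans (Finset.sum_congr rfl fun r _ => ?_)
  rw [tensorForm_coeffW_comulW]

/-! ### Polyvector fields -/

theorem neg_one_pow_congr {R : Type*} [Monoid R] [HasDistribNeg R] {x y : ℕ}
    (h : Even x ↔ Even y) : (-1 : R) ^ x = (-1) ^ y := by
  by_cases hx : Even x
  · rw [hx.neg_one_pow, (h.1 hx).neg_one_pow]
  · rw [(Nat.not_even_iff_odd.1 hx).neg_one_pow,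
      (Nat.not_even_iff_odd.1 (mt h.2 hx)).neg_one_pow]

theorem negOnePow_eq_neg_one_pow {z : ℤ} {x : ℕ} (h : Even z ↔ Even x) :
    (Int.negOnePow z : ℤ) = (-1) ^ x := by
  by_cases hx : Even x
  · rw [hx.neg_one_pow, Int.negOnePow_even _ (h.2 hx)]
    rfl
  · rw [(Nat.not_even_iff_odd.1 hx).neg_one_pow,
      Int.negOnePow_odd _ (Int.not_even_iff_odd.1 (mt h.1 hx))]
    rfl

theorem delList_nil : delList k ([] : List (Fin n)) = 1 := rfl

theorem delList_cons (i : Fin n) (l : List (Fin n)) :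
    delList k (i :: l) = del k i * delList k l := by
  simp [delList]

theorem delList_append (l l' : List (Fin n)) :
    delList k (l ++ l') = delList k l * delList k l' := by
  simp [delList]

theorem del_mul_del (i j : Fin n) : del k i * del k j = -(del k j * del k i) :=
  eq_neg_of_add_eq_zero_left (ExteriorAlgebra.ι_add_mul_swap _ _)

theorem del_mul_delList (i : Fin n) (l : List (Fin n)) :
    del k i * delList k l = (-1 : ℤ) ^ l.length • (delList k l * del k i) := by
  induction l with
  | nil => simp [delList_nil]
  | cons j l ih =>
    rw [delList_cons, ← mul_assoc, del_mul_del, neg_mul, mul_assoc, ih, mul_smul_comm, mul_assoc,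
      List.length_cons, pow_succ, mul_neg_one, neg_smul]

theorem delList_mul_delList (l l' : List (Fin n)) :
    delList k l * delList k l' =
      (-1 : ℤ) ^ (l.length * l'.length) • (delList k l' * delList k l) := by
  induction l with
  | nil => simp [delList_nil]
  | cons j l ih =>
    rw [delList_cons, mul_assoc, ih, mul_smul_comm, ← mul_assoc, del_mul_delList, smul_mul_assoc,
      smul_smul, ← pow_add, mul_assoc, List.length_cons, add_mul, one_mul]

theorem delList_eq_ofFn {l : List (Fin n)} {r : ℕ} (h : l.length = r) : delList k l =
    ExteriorAlgebra.ιMulti (A k n) r fun j => Pi.single (l.get (j.cast h.symm)) 1 := by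
  subst h
  exact delList_eq_ιMulti k l

theorem delList_mem (l : List (Fin n)) :
    delList k l ∈ ⋀[A k n]^l.length (Fin n → A k n) := by
  rw [delList_eq_ιMulti]
  exact ExteriorAlgebra.ιMulti_range _ _ ⟨_, rfl⟩

theorem exteriorPower_le_span (p : ℕ) : ⋀[A k n]^p (Fin n → A k n) ≤
    Submodule.span (A k n) {x | ∃ I : Finset (Fin n), I.card = p ∧ x = delList k I.sort} := by
  have hb : Submodule.span (A k n) (Set.range fun i : Fin n => (Pi.single i 1 : Fin n → A k n)) =
      ⊤ := by
    rw [← (Pi.basisFun (A k n) (Fin n)).span_eq]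
    congr 2
    exact funext fun i => (Pi.basisFun_apply _ _ i).symm
  have h := exteriorPower.ιMulti_family_span_of_span (n := p) (A k n) hb
  have h' := congrArg (Submodule.map (⋀[A k n]^p (Fin n → A k n)).subtype) h
  rw [Submodule.map_span, Submodule.map_top, Submodule.range_subtype, ← Set.range_comp] at h'
  rw [← h']
  refine Submodule.span_mono ?_
  rintro _ ⟨s, rfl⟩
  refine ⟨s.1, s.2, ?_⟩
  obtain ⟨s, rfl⟩ := s
  refine (delList_eq_ofFn k (Finset.length_sort _)).symm

theorem top_le_span : ⊤ ≤ Submodule.span (A k n)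
    (Set.range fun I : Finset (Fin n) => delList k I.sort) := by
  rw [← ExteriorAlgebra.ιMulti_span, Submodule.span_le]
  rintro _ ⟨⟨p, v⟩, rfl⟩
  refine Submodule.span_mono ?_
    (exteriorPower_le_span k p (ExteriorAlgebra.ιMulti_range _ _ ⟨v, rfl⟩))
  rintro _ ⟨I, -, rfl⟩
  exact ⟨I, rfl⟩

variable {k} in
/-- Induction on homogeneous polyvector fields of degree `p`. -/
theorem exteriorPower_induction {p : ℕ}
    {P : ∀ x : Polyvector k n, x ∈ ⋀[A k n]^p (Fin n → A k n) → Prop}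
    (zero : P 0 (Submodule.zero_mem _))
    (add : ∀ x y hx hy, P x hx → P y hy → P (x + y) (Submodule.add_mem _ hx hy))
    (basis : ∀ (a : A k n) (I : List (Fin n)) (_ : I.SortedLT) (h : I.length = p),
      P (a • delList k I) (Submodule.smul_mem _ _ (h ▸ delList_mem k I)))
    {x : Polyvector k n} (hx : x ∈ ⋀[A k n]^p (Fin n → A k n)) : P x hx := by
  suffices h : ∃ hx, P x hx from h.2
  -- Induction runs over sums of `A`-multiples of generators, so the predicate need not be stable
  -- under `A`: the operations of interest are not `A`-linear in both arguments.
  refine Submodule.closure_induction (p := fun x _ => ∃ hx, P x hx) ⟨_, zero⟩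
    (fun x y _ _ hx hy => ⟨_, add x y _ _ hx.2 hy.2⟩) ?_ (exteriorPower_le_span k p hx)
  rintro a _ ⟨I, hI, rfl⟩
  exact ⟨_, basis a _ (Finset.sortedLT_sort I) ((Finset.length_sort _).trans hI)⟩

variable {k} in
/-- Induction on polyvector fields. -/
theorem polyvector_induction {P : Polyvector k n → Prop}
    (add : ∀ x y, P x → P y → P (x + y))
    (basis : ∀ (a : A k n) (I : List (Fin n)), I.SortedLT → P (a • delList k I))
    (x : Polyvector k n) : P x := by
  refine Submodule.closure_induction (p := fun x _ => P x) ?_ (fun x y _ _ => add x y) ?_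
    (top_le_span k (Submodule.mem_top (x := x)))
  · simpa using basis 0 [] List.Pairwise.nil.sortedLT
  · rintro a _ ⟨I, rfl⟩
    exact basis a _ (Finset.sortedLT_sort I)

theorem polyvectorCoeff_delList_sort (I J : Finset (Fin n)) :
    polyvectorCoeff k I (delList k J.sort) =
      if I = J then (-1) ^ (J.card * (J.card - 1) / 2) else 0 := by
  rw [polyvectorCoeff_delList, coeffW_o_sort, Finset.length_sort, apply_ite MvPolynomial.C,
    map_one, map_zero, mul_ite, mul_one, mul_zero]
  exact if_congr eq_comm rfl rfl

/-- The increasing `∂_J` span, and the coordinate maps are diagonal on them with entries `±1`. -/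
theorem bijective_pi_polyvectorCoeff : Function.Bijective
    (LinearMap.pi fun I => polyvectorCoeff k I :
      Polyvector k n →ₗ[A k n] Finset (Fin n) → A k n) := by
  constructor
  · refine (injective_iff_map_eq_zero _).2 fun x hx => ?_
    obtain ⟨c, rfl⟩ := (Submodule.mem_span_range_iff_exists_fun _).1
      (top_le_span k (Submodule.mem_top (x := x)))
    refine Finset.sum_eq_zero fun J _ => ?_
    have h := congrFun hx J
    rw [LinearMap.pi_apply, map_sum] at h
    simp only [map_smul, polyvectorCoeff_delList_sort, smul_ite, smul_zero] at h
    rw [Finset.sum_ite_eq, if_pos (Finset.mem_univ _), smul_eq_mul] at h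
    have hc : c J = 0 := by simpa using h
    rw [hc, zero_smul]
  · intro y
    refine ⟨∑ J : Finset (Fin n),
      ((-1) ^ (J.card * (J.card - 1) / 2) * y J) • delList k J.sort, funext fun I => ?_⟩
    rw [LinearMap.pi_apply, map_sum]
    simp only [map_smul, polyvectorCoeff_delList_sort, smul_ite, smul_zero]
    rw [Finset.sum_ite_eq, if_pos (Finset.mem_univ _), smul_eq_mul, mul_right_comm, ← mul_pow]
    simp

/-- Polyvector fields in terms of their coordinates. -/
def coordEquiv : Polyvector k n ≃ₗ[A k n] (Finset (Fin n) → A k n) :=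
  LinearEquiv.ofBijective _ (bijective_pi_polyvectorCoeff k)

theorem toCochain_injective : Function.Injective (toCochain k n) :=
  (extendW_injective k).comp
    (((basisW k n).constr (A k n)).injective.comp (bijective_pi_polyvectorCoeff k).1)

theorem range_toCochain : Set.range (toCochain k n) = cochains k n := by
  rw [← range_extendW]
  exact (((basisW k n).constr (A k n)).surjective.comp
    (bijective_pi_polyvectorCoeff k).2).range_comp (extendW k n)

/-! ### Coefficient derivatives, contractions and graded commutativity -/

/-- The derivation `∂/∂x_i` acting on the coefficients of polyvector fields. -/
def coeffDeriv (i : Fin n) : Polyvector k n →ₗ[k] Polyvector k n :=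
  ((coordEquiv k).symm.toLinearMap.restrictScalars k) ∘ₗ
    (LinearMap.pi fun I => (MvPolynomial.pderiv i).toLinearMap ∘ₗ LinearMap.proj I) ∘ₗ
    ((coordEquiv k).toLinearMap.restrictScalars k)

/-- The coordinates of any `∂_l` are constants from `k`, so they pass through the derivative; no
ordering of `l` is needed. -/
theorem coeffDeriv_smul_delList (i : Fin n) (a : A k n) (l : List (Fin n)) :
    coeffDeriv k i (a • delList k l) = MvPolynomial.pderiv i a • delList k l := by
  refine (coordEquiv k).injective (funext fun I => ?_)
  have h : ∀ b : A k n, coordEquiv k (b • delList k l) I =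
      MvPolynomial.C ((-1) ^ (l.length * (l.length - 1) / 2) * coeffW k l (o k I.sort)) * b := by
    intro b
    rw [map_smul, Pi.smul_apply, smul_eq_mul, mul_comm, map_mul, map_pow, map_neg, map_one,
      ← polyvectorCoeff_delList]
    rfl
  rw [h, coeffDeriv]
  simp only [LinearMap.comp_apply, LinearMap.restrictScalars_apply, LinearEquiv.coe_coe,
    LinearEquiv.apply_symm_apply, LinearMap.pi_apply, LinearMap.proj_apply, h]
  exact MvPolynomial.pderiv_C_mul

theorem coeffDeriv_mul (i : Fin n) (x y : Polyvector k n) :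
    coeffDeriv k i (x * y) = coeffDeriv k i x * y + x * coeffDeriv k i y := by
  induction x using polyvector_induction with
  | add x x' hx hx' =>
    simp only [add_mul, map_add, hx, hx']
    abel
  | basis a I _ =>
  induction y using polyvector_induction with
  | add y y' hy hy' =>
    simp only [mul_add, map_add, hy, hy']
    abel
  | basis b J _ =>
  rw [smul_mul_smul_comm, ← delList_append]
  simp only [coeffDeriv_smul_delList]
  rw [smul_mul_smul_comm, smul_mul_smul_comm, ← delList_append, ← add_smul, Derivation.leibniz,
    smul_eq_mul, smul_eq_mul, mul_comm b, add_comm]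

/-- The contraction of polyvector fields with `dx_i`. -/
def contract (i : Fin n) : Polyvector k n →ₗ[A k n] Polyvector k n :=
  CliffordAlgebra.contractLeft (Q := 0) (LinearMap.proj i)

theorem contract_del_mul (i j : Fin n) (x : Polyvector k n) :
    contract k i (del k j * x) = (if j = i then x else 0) - del k j * contract k i x := by
  refine (CliffordAlgebra.contractLeft_ι_mul _ _ _).trans ?_
  rw [LinearMap.proj_apply, Pi.single_apply, ite_smul, one_smul, zero_smul]
  simp only [eq_comm]
  rfl

theorem contract_one (i : Fin n) : contract k i (1 : Polyvector k n) = 0 :=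
  CliffordAlgebra.contractLeft_one 0 _

theorem contract_delList (i : Fin n) (l : List (Fin n)) :
    contract k i (delList k l) = ∑ r : Fin l.length,
      if l[r]'r.2 = i then (-1 : ℤ) ^ (r : ℕ) • delList k (l.take r ++ l.drop (r + 1)) else 0 := by
  induction l with
  | nil => exact contract_one k i
  | cons j l ih =>
    rw [delList_cons, contract_del_mul, ih]
    simp only [List.length_cons]
    rw [Fin.sum_univ_succ, sub_eq_add_neg, Finset.mul_sum, ← Finset.sum_neg_distrib]
    congr 1
    · simp
    · refine Finset.sum_congr rfl fun r _ => ?_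
      rw [mul_ite, mul_zero, mul_smul_comm, ← delList_cons]
      by_cases h : l[r]'r.2 = i
      · simp_all [pow_succ]
      · simp_all

theorem contract_delList_mul (i : Fin n) (l : List (Fin n)) (x : Polyvector k n) :
    contract k i (delList k l * x) =
      contract k i (delList k l) * x + (-1 : ℤ) ^ l.length • (delList k l * contract k i x) := by
  induction l with
  | nil => simp [delList_nil, contract_one]
  | cons j l ih =>
    rw [delList_cons, mul_assoc, contract_del_mul, contract_del_mul, ih, List.length_cons,
      pow_succ, mul_neg_one, neg_smul, mul_add, sub_mul, ite_mul, zero_mul, mul_smul_comm,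
      mul_assoc, mul_assoc]
    abel

theorem contract_mul {p : ℕ} (i : Fin n) {x : Polyvector k n}
    (hx : x ∈ ⋀[A k n]^p (Fin n → A k n)) (y : Polyvector k n) :
    contract k i (x * y) =
      contract k i x * y + (-1 : ℤ) ^ p • (x * contract k i y) := by
  induction hx using exteriorPower_induction with
  | zero => simp
  | add x x' _ _ hx hx' =>
    simp only [add_mul, map_add, hx, hx', smul_add]
    abel
  | basis a I _ hI =>
    rw [smul_mul_assoc, map_smul, contract_delList_mul, map_smul, smul_mul_assoc, smul_mul_assoc,
      hI, smul_add, smul_comm a]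

/-- Graded commutativity. -/
theorem mul_comm_of_mem {p q : ℕ} {x y : Polyvector k n}
    (hx : x ∈ ⋀[A k n]^p (Fin n → A k n)) (hy : y ∈ ⋀[A k n]^q (Fin n → A k n)) :
    x * y = (-1 : ℤ) ^ (p * q) • (y * x) := by
  induction hx using exteriorPower_induction with
  | zero => simp
  | add x x' _ _ hx hx' => simp only [add_mul, mul_add, smul_add, hx, hx']
  | basis a I _ hI =>
  induction hy using exteriorPower_induction with
  | zero => simp
  | add y y' _ _ hy hy' => simp only [add_mul, mul_add, smul_add, hy, hy']
  | basis b J _ hJ =>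
    rw [smul_mul_smul_comm, smul_mul_smul_comm, delList_mul_delList, hI, hJ, smul_comm (a * b),
      mul_comm b]

theorem coeffDeriv_mem {p : ℕ} (i : Fin n) {x : Polyvector k n}
    (hx : x ∈ ⋀[A k n]^p (Fin n → A k n)) : coeffDeriv k i x ∈ ⋀[A k n]^p (Fin n → A k n) := by
  induction hx using exteriorPower_induction with
  | zero => simp
  | add x x' _ _ hx hx' => rw [map_add]; exact Submodule.add_mem _ hx hx'
  | basis a I _ hI =>
    rw [coeffDeriv_smul_delList, ← hI]
    exact Submodule.smul_mem _ _ (delList_mem k I)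

theorem contract_mem {p : ℕ} (i : Fin n) {x : Polyvector k n}
    (hx : x ∈ ⋀[A k n]^(p + 1) (Fin n → A k n)) :
    contract k i x ∈ ⋀[A k n]^p (Fin n → A k n) := by
  induction hx using exteriorPower_induction with
  | zero => simp
  | add x x' _ _ hx hx' => rw [map_add]; exact Submodule.add_mem _ hx hx'
  | basis a I _ hI =>
    rw [map_smul, contract_delList]
    refine Submodule.smul_mem _ _ (Submodule.sum_mem _ fun r _ => ?_)
    split_ifs
    · refine zsmul_mem ?_ _
      have h : (I.take r ++ I.drop (r + 1)).length = p := by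
        have := r.2
        simp only [List.length_append, List.length_take, List.length_drop]
        omega
      rw [← h]
      exact delList_mem k _
    · exact Submodule.zero_mem _

theorem contract_eq_zero (i : Fin n) {x : Polyvector k n}
    (hx : x ∈ ⋀[A k n]^0 (Fin n → A k n)) : contract k i x = 0 := by
  induction hx using exteriorPower_induction with
  | zero => simp
  | add x x' _ _ hx hx' => rw [map_add, hx, hx', add_zero]
  | basis a I _ hI =>
    rw [List.length_eq_zero_iff.1 hI, map_smul, contract_delList]
    simp

/-- Graded commutativity, for a contracted factor. -/
theorem contract_mul_comm {p q : ℕ} (i : Fin n) {x y : Polyvector k n}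
    (hx : x ∈ ⋀[A k n]^p (Fin n → A k n)) (hy : y ∈ ⋀[A k n]^q (Fin n → A k n)) :
    contract k i x * y = (-1 : ℤ) ^ ((p + 1) * q) • (y * contract k i x) := by
  -- The contracted factor has degree `p - 1`, of the parity of `p + 1`; for `p = 0` it vanishes, so
  -- the sign is immaterial.
  cases p with
  | zero => rw [contract_eq_zero k i hx, zero_mul, mul_zero, smul_zero]
  | succ p =>
    rw [mul_comm_of_mem k (contract_mem k i hx) hy]
    congr 1
    exact neg_one_pow_congr (by simp only [Nat.even_mul, Nat.even_add_one]; tauto)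

theorem involute_of_mem {p : ℕ} {x : Polyvector k n}
    (hx : x ∈ ⋀[A k n]^p (Fin n → A k n)) :
    CliffordAlgebra.involute x = (-1 : ℤ) ^ p • x := by
  induction hx using exteriorPower_induction with
  | zero => simp
  | add x x' _ _ hx hx' => rw [map_add, hx, hx', smul_add]
  | basis a I hs hI =>
    clear hs
    subst hI
    rw [map_smul, smul_comm _ a]
    congr 1
    induction I with
    | nil => simp [delList_nil]
    | cons j l ih =>
      have : CliffordAlgebra.involute (del k j) = -del k j := CliffordAlgebra.involute_ι _
      rw [delList_cons, map_mul, ih, this, mul_smul_comm, List.length_cons, pow_succ, mul_neg_one,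
        neg_smul, neg_mul, smul_neg]

/-! ### The circle product and the bracket on polyvector fields -/

/-- Additivity defect of the triangular numbers, the exponents normalising the dual basis. -/
theorem half_mul_add (m q : ℕ) : (m + q) * (m + q - 1) / 2 =
    m * (m - 1) / 2 + q * (q - 1) / 2 + m * q := by
  simp only [← Nat.choose_two_right]
  induction q with
  | zero => simp
  | succ q ih =>
    rw [← add_assoc, Nat.choose_succ_succ' (m + q) 1, ih, Nat.choose_succ_succ' q 1]
    simp only [Nat.choose_one_right]
    ring

variable (n) in
/-- The operation `ω, η ↦ -∑_i (dx_i ⌟ ω̄) ∂η/∂x_i`, where `ω̄ = (-1)^{|ω|} ω`. -/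
def circPoly : Polyvector k n →ₗ[k] Polyvector k n →ₗ[k] Polyvector k n :=
  -∑ i : Fin n, (LinearMap.mul k (Polyvector k n)).compl₁₂
    (((contract k i) ∘ₗ CliffordAlgebra.involute.toLinearMap).restrictScalars k) (coeffDeriv k i)

variable (n) in
/-- The Schouten–Nijenhuis bracket `ω, η ↦ -∑_i ((dx_i ⌟ ω̄) ∂η/∂x_i + ∂ω/∂x_i (dx_i ⌟ η))`. -/
def schouten : Polyvector k n →ₗ[k] Polyvector k n →ₗ[k] Polyvector k n :=
  circPoly k n - ∑ i : Fin n, (LinearMap.mul k (Polyvector k n)).compl₁₂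
    (coeffDeriv k i) ((contract k i).restrictScalars k)

theorem circPoly_apply {p : ℕ} {x : Polyvector k n} (hx : x ∈ ⋀[A k n]^p (Fin n → A k n))
    (y : Polyvector k n) :
    circPoly k n x y = (-1 : ℤ) ^ (p + 1) • ∑ i, contract k i x * coeffDeriv k i y := by
  have h : circPoly k n x y =
      -∑ i, contract k i (CliffordAlgebra.involute x) * coeffDeriv k i y := by
    simp [circPoly, LinearMap.sum_apply]
  rw [h, involute_of_mem k hx]
  simp only [map_zsmul, smul_mul_assoc]
  rw [← Finset.smul_sum, pow_succ, mul_neg_one, neg_smul]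

theorem schouten_apply {p : ℕ} {x : Polyvector k n} (hx : x ∈ ⋀[A k n]^p (Fin n → A k n))
    (y : Polyvector k n) :
    schouten k n x y = (-1 : ℤ) ^ (p + 1) • ∑ i, contract k i x * coeffDeriv k i y -
      ∑ i, coeffDeriv k i x * contract k i y := by
  rw [← circPoly_apply k hx]
  simp [schouten, LinearMap.sum_apply]

theorem smul_delList_mem (a : A k n) (I : List (Fin n)) :
    a • delList k I ∈ ⋀[A k n]^I.length (Fin n → A k n) :=
  Submodule.smul_mem _ _ (delList_mem k I)

theorem circPoly_smul_delList (a b : A k n) (I J : List (Fin n)) :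
    circPoly k n (a • delList k I) (b • delList k J) = ∑ r : Fin I.length,
      (-1 : ℤ) ^ (I.length + 1 + r) • (a * MvPolynomial.pderiv (I[r]'r.2) b) •
        delList k (I.take r ++ I.drop (r + 1) ++ J) := by
  rw [circPoly_apply k (smul_delList_mem k a I)]
  simp only [map_smul, contract_delList, coeffDeriv_smul_delList, Finset.smul_sum, Finset.sum_mul]
  rw [Finset.sum_comm]
  refine Finset.sum_congr rfl fun r _ => ?_
  rw [Finset.sum_eq_single (I[r]'r.2)]
  · rw [if_pos rfl, smul_mul_smul_comm, smul_mul_assoc, ← delList_append,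
      smul_comm (a * _) ((-1 : ℤ) ^ (r : ℕ)), smul_smul, ← pow_add]
  · intro i _ hi
    rw [if_neg hi.symm, smul_zero, zero_mul, smul_zero]
  · simp

theorem delList_take_drop_append (I J : List (Fin n)) (r : Fin I.length) :
    delList k (I.take r ++ I.drop (r + 1) ++ J) =
      (-1 : ℤ) ^ ((I.length - (r + 1)) * J.length) •
        delList k (I.take r ++ J ++ I.drop (r + 1)) := by
  rw [List.append_assoc, delList_append, delList_append k (I.drop _), delList_mul_delList,
    List.append_assoc, delList_append, delList_append, mul_smul_comm, List.length_drop]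

/-- The circle product on `K` yields words with the tail of `I` in front and its head behind; this
compares them with the order that contraction produces. -/
theorem delList_rotate (I J : List (Fin n)) (r : Fin I.length) :
    delList k (I.take r ++ I.drop (r + 1) ++ J) =
      (-1 : ℤ) ^ (r * (I.length - (r + 1) + J.length)) •
        delList k (I.drop (r + 1) ++ J ++ I.take r) := by
  rw [List.append_assoc, delList_append, delList_mul_delList, ← delList_append,
    List.length_append, List.length_drop, List.length_take, min_eq_left r.2.le]

/-- With `r` and `s` the lengths of head and tail, the left side collects the Koszul sign, the sign
of `φ` and the normalisations of `I` and `J`; the right side the sign of `circPoly`, the rotation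
and the normalisation of the resulting word. -/
theorem circ_sign (R : Type*) [CommRing R] {p r s : ℕ} (hp : p = r + s + 1) (q : ℕ) :
    (-1 : R) ^ (s * q) * (-1) ^ (s * r + r) * (-1) ^ (p * (p - 1) / 2) *
        (-1) ^ (q * (q - 1) / 2) =
      (-1) ^ (p + 1 + r) * (-1) ^ (r * (s + q)) *
        (-1) ^ ((r + s + q) * (r + s + q - 1) / 2) := by
  rw [hp, half_mul_add (r + s) 1, half_mul_add (r + s) q]
  simp only [← pow_add]
  refine neg_one_pow_congr ?_
  generalize (r + s) * (r + s - 1) / 2 = e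
  generalize q * (q - 1) / 2 = e'
  simp only [Nat.even_add, Nat.even_mul, Nat.even_add_one]
  by_cases hr : Even r <;> by_cases hs : Even s <;> by_cases hq : Even q <;>
    by_cases he : Even e <;> by_cases he' : Even e' <;> simp [hr, hs, hq, he, he']

theorem circ_toCochain_of_sortedLT {I : List (Fin n)} (hI : I.SortedLT) (a b : A k n)
    (J : List (Fin n)) :
    circ J.length (toCochain k n (a • delList k I)) (toCochain k n (b • delList k J)) =
      toCochain k n (circPoly k n (a • delList k I) (b • delList k J)) := by
  refine K_hom_ext fun c w c' => ?_
  rw [circPoly_smul_delList, map_sum, LinearMap.sum_apply, toCochain_smul_delList,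
    toCochain_smul_delList]
  rw [circ_apply_tmul k J.length (extendW_mem_cochains k _)
    (fun r : Fin I.length => (-1) ^ ((I.drop (r + 1)).length * r + r) *
      ((-1) ^ (I.length * (I.length - 1) / 2) * a))
    (fun r => (MvPolynomial.pderiv (I[r]'r.2)).toLinearMap) (fun r => I.drop (r + 1))
    (fun r => I.take r) (fun w d w' => extendW_phiGen k hI _ d w w')]
  refine Finset.sum_congr rfl fun r _ => ?_
  obtain ⟨s, hs⟩ : ∃ s, I.length = r + s + 1 := ⟨I.length - (r + 1), by have := r.2; omega⟩
  have hd : (I.drop (r + 1)).length = s := by rw [List.length_drop]; omega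
  have ht : (I.take r).length = r := by rw [List.length_take]; omega
  -- The normalising sign of `J` is part of the coefficient being differentiated, but is constant.
  have hD : MvPolynomial.pderiv (I[r]'r.2) ((-1) ^ (J.length * (J.length - 1) / 2) * b) =
      (-1) ^ (J.length * (J.length - 1) / 2) * MvPolynomial.pderiv (I[r]'r.2) b := by
    have : ((-1) ^ (J.length * (J.length - 1) / 2) : A k n) =
        MvPolynomial.C ((-1) ^ (J.length * (J.length - 1) / 2)) := by simp
    rw [this, MvPolynomial.pderiv_C_mul]
  rw [delList_rotate, smul_comm (a * _), smul_smul, map_zsmul, LinearMap.smul_apply,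
    toCochain_smul_delList_tmul, Derivation.coeFn_coe, hD, zsmul_eq_mul]
  simp only [List.length_append, hd, ht]
  have hs' : I.length - (r + 1) = s := by omega
  rw [hs', show s + J.length + r = (r + s) + J.length by ring]
  have key := circ_sign (A k n) hs J.length
  push_cast
  linear_combination c * (a * MvPolynomial.pderiv (I[r]'r.2) b *
    MvPolynomial.C (coeffW k (I.drop (r + 1) ++ J ++ I.take r) w) * c') * key

theorem circ_add_left (q : ℕ) (f f' g : K k n →ₗ[k] A k n) :
    circ q (f + f') g = circ q f g + circ q f' g :=
  LinearMap.add_comp _ _ _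

theorem circ_add_right (q : ℕ) (f g g' : K k n →ₗ[k] A k n) :
    circ q f (g + g') = circ q f g + circ q f g' := by
  simp only [circ, idTensorId, tensorId, LinearMap.add_comp, LinearMap.comp_add,
    LinearMap.rTensor_add, LinearMap.lTensor_add, TensorProduct.map_add_right]

theorem circ_zero_right (q : ℕ) (f : K k n →ₗ[k] A k n) : circ q f 0 = 0 := by
  simpa using circ_add_right k q f 0 0

/-- The `φ`-circle product in terms of polyvector fields. -/
theorem circ_toCochain {q : ℕ} (x : Polyvector k n) {y : Polyvector k n}
    (hy : y ∈ ⋀[A k n]^q (Fin n → A k n)) :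
    circ q (toCochain k n x) (toCochain k n y) = toCochain k n (circPoly k n x y) := by
  -- Additivity in `x` reduces to increasing words, the only ones for which the formula for `φ` was
  -- computed.
  induction x using polyvector_induction with
  | add x x' hx hx' =>
    rw [map_add, circ_add_left, hx, hx', map_add, LinearMap.add_apply, map_add]
  | basis a I hI =>
  induction hy using exteriorPower_induction with
  | zero => rw [map_zero, map_zero, map_zero, circ_zero_right]
  | add y y' _ _ hy hy' => rw [map_add, circ_add_right, hy, hy', map_add, map_add]
  | basis b J _ hJ =>
    subst hJ
    exact circ_toCochain_of_sortedLT k hI a b J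

theorem toCochain_bracket {p q : ℕ} {x y : Polyvector k n}
    (hx : x ∈ ⋀[A k n]^p (Fin n → A k n)) (hy : y ∈ ⋀[A k n]^q (Fin n → A k n)) :
    bracket p q (toCochain k n x) (toCochain k n y) =
      toCochain k n (circPoly k n x y -
        (Int.negOnePow (((p : ℤ) - 1) * ((q : ℤ) - 1)) : ℤ) • circPoly k n y x) := by
  rw [bracket, circ_toCochain k x hy, circ_toCochain k y hx, map_sub, map_zsmul]

/-- Commuting `∂x/∂x_i` past the contraction of `y` turns the second sum of `schouten` into the
signed `circPoly` with arguments exchanged. -/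
theorem schouten_eq {p q : ℕ} {x y : Polyvector k n}
    (hx : x ∈ ⋀[A k n]^p (Fin n → A k n)) (hy : y ∈ ⋀[A k n]^q (Fin n → A k n)) :
    schouten k n x y = circPoly k n x y -
        (Int.negOnePow (((p : ℤ) - 1) * ((q : ℤ) - 1)) : ℤ) • circPoly k n y x := by
  rw [circPoly_apply k hx, circPoly_apply k hy, schouten_apply k hx, smul_smul,
    Finset.smul_sum (r := _ * _)]
  congr 1
  refine Finset.sum_congr rfl fun i _ => ?_
  rw [contract_mul_comm k i hy (coeffDeriv_mem k i hx), smul_smul,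
    -- The signs add up to `(p+1)(q+1) + (q+1) + (q+1)p = 2(p+1)(q+1)`, which is even.
    negOnePow_eq_neg_one_pow (x := (p + 1) * (q + 1)), ← pow_add, ← pow_add, Even.neg_one_pow,
    one_smul]
  · simp only [Nat.even_add, Nat.even_mul, Nat.even_add_one]
    tauto
  · simp only [Int.even_mul, Int.even_sub, Int.even_coe_nat, Nat.even_mul, Nat.even_add_one]
    simp

/-! ### The Schouten–Nijenhuis axioms and uniqueness -/

theorem algebraMap_eq_smul_delList (a : A k n) :
    algebraMap (A k n) (Polyvector k n) a = a • delList k [] := by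
  rw [delList_nil, Algebra.algebraMap_eq_smul_one]

theorem smul_del_eq_smul_delList (a : A k n) (i : Fin n) : a • del k i = a • delList k [i] := by
  rw [delList_cons, delList_nil, mul_one]

theorem schouten_smul_delList (a b : A k n) (I J : List (Fin n)) :
    schouten k n (a • delList k I) (b • delList k J) =
      circPoly k n (a • delList k I) (b • delList k J) -
        (Int.negOnePow (((I.length : ℤ) - 1) * ((J.length : ℤ) - 1)) : ℤ) •
          circPoly k n (b • delList k J) (a • delList k I) :=
  schouten_eq k (smul_delList_mem k a I) (smul_delList_mem k b J)

/-- In the first sum `y` passes a contraction of `x`, with sign exponent `(p+1)q`. In the second it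
passes `∂x/∂x_i`, with exponent `pq`, and the antiderivation rule supplies the missing `q`. -/
theorem schouten_mul {p q : ℕ} {x y : Polyvector k n} (hx : x ∈ ⋀[A k n]^p (Fin n → A k n))
    (hy : y ∈ ⋀[A k n]^q (Fin n → A k n)) (z : Polyvector k n) :
    schouten k n x (y * z) =
      schouten k n x y * z + (-1 : ℤ) ^ ((p + 1) * q) • (y * schouten k n x z) := by
  have h₁ : ∀ i, contract k i x * (y * coeffDeriv k i z) =
      (-1 : ℤ) ^ ((p + 1) * q) • (y * (contract k i x * coeffDeriv k i z)) := fun i => by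
    rw [← mul_assoc, contract_mul_comm k i hx hy, smul_mul_assoc, mul_assoc]
  have h₂ : ∀ i, coeffDeriv k i x * ((-1 : ℤ) ^ q • (y * contract k i z)) =
      (-1 : ℤ) ^ ((p + 1) * q) • (y * (coeffDeriv k i x * contract k i z)) := fun i => by
    rw [mul_smul_comm, ← mul_assoc, mul_comm_of_mem k (coeffDeriv_mem k i hx) hy, smul_mul_assoc,
      mul_assoc, smul_smul, ← pow_add, add_mul, one_mul, add_comm]
  simp only [schouten_apply k hx, coeffDeriv_mul, contract_mul k _ hy, mul_add,
    Finset.sum_add_distrib, h₁, h₂, ← Finset.smul_sum, ← Finset.mul_sum, sub_mul, smul_add,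
    mul_sub, smul_sub, smul_mul_assoc, mul_smul_comm, Finset.sum_mul, mul_assoc]
  rw [smul_comm ((-1 : ℤ) ^ (p + 1)) ((-1 : ℤ) ^ ((p + 1) * q))]
  abel

theorem isSchoutenNijenhuis_schouten : IsSchoutenNijenhuis (schouten k n) where
  fun_fun a b := by
    rw [algebraMap_eq_smul_delList, algebraMap_eq_smul_delList, schouten_smul_delList,
      circPoly_smul_delList, circPoly_smul_delList]
    simp
  vector_fun a b i := by
    rw [algebraMap_eq_smul_delList, algebraMap_eq_smul_delList, smul_del_eq_smul_delList,
      schouten_smul_delList, circPoly_smul_delList, circPoly_smul_delList]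
    simp
  vector_vector a b i j := by
    rw [smul_del_eq_smul_delList, smul_del_eq_smul_delList, smul_del_eq_smul_delList,
      smul_del_eq_smul_delList, schouten_smul_delList, circPoly_smul_delList,
      circPoly_smul_delList]
    simp
  antisymm p q x y hx hy := by
    rw [schouten_eq k hx hy, schouten_eq k hy hx, smul_sub, smul_smul,
      mul_comm ((q : ℤ) - 1) ((p : ℤ) - 1), neg_sub, ← Units.val_mul, Int.units_mul_self,
      Units.val_one, one_smul]
  leibniz p q x y z hx hy := by
    rw [schouten_mul k hx hy, negOnePow_eq_neg_one_pow (x := (p + 1) * q)]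
    simp only [Int.even_mul, Int.even_sub, Int.even_coe_nat, Nat.even_mul, Nat.even_add_one]
    simp

variable {k} in
/-- The Leibniz rule determines the operation from its values on functions and vector fields. -/
theorem IsSchoutenNijenhuis.ext_right
    {β β' : Polyvector k n →ₗ[k] Polyvector k n →ₗ[k] Polyvector k n}
    (h : IsSchoutenNijenhuis β) (h' : IsSchoutenNijenhuis β') {p : ℕ} {x : Polyvector k n}
    (hx : x ∈ ⋀[A k n]^p (Fin n → A k n))
    (hfun : ∀ b : A k n, β x (b • delList k []) = β' x (b • delList k []))
    (hvec : ∀ (b : A k n) j, β x (b • delList k [j]) = β' x (b • delList k [j])) : β x = β' x := by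
  refine LinearMap.ext fun y => ?_
  induction y using polyvector_induction with
  | add y y' hy hy' => rw [map_add, map_add, hy, hy']
  | basis b J hJ =>
    clear hJ
    induction J generalizing b with
    | nil => exact hfun b
    | cons j J ih =>
      -- One vector field carrying the whole coefficient is split off, leaving a shorter word for
      -- the induction.
      have e : b • delList k (j :: J) = (b • delList k [j]) * ((1 : A k n) • delList k J) := by
        rw [smul_mul_smul_comm, mul_one, ← delList_append, List.singleton_append]
      rw [e, h.leibniz p 1 _ _ _ hx (smul_delList_mem k b [j]),
        h'.leibniz p 1 _ _ _ hx (smul_delList_mem k b [j]), hvec, ih]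

variable {k} in
-- The values with a function or vector field on the left are settled first. Antisymmetry then gives
-- those with one on the right, and the Leibniz rule extends to all second arguments.
theorem IsSchoutenNijenhuis.unique
    {β β' : Polyvector k n →ₗ[k] Polyvector k n →ₗ[k] Polyvector k n}
    (h : IsSchoutenNijenhuis β) (h' : IsSchoutenNijenhuis β') : β = β' := by
  have hvf : ∀ (a b : A k n) (i : Fin n), β (a • delList k [i]) (b • delList k []) =
      β' (a • delList k [i]) (b • delList k []) := fun a b i => by
    rw [← algebraMap_eq_smul_delList, ← smul_del_eq_smul_delList, h.vector_fun, h'.vector_fun]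
  have hf : ∀ a : A k n, β (a • delList k []) = β' (a • delList k []) := fun a => by
    refine h.ext_right h' (smul_delList_mem k a []) (fun b => ?_) fun b j => ?_
    · rw [← algebraMap_eq_smul_delList, ← algebraMap_eq_smul_delList, h.fun_fun, h'.fun_fun]
    · rw [h.antisymm _ _ _ _ (smul_delList_mem k a []) (smul_delList_mem k b [j]),
        h'.antisymm _ _ _ _ (smul_delList_mem k a []) (smul_delList_mem k b [j]), hvf]
  have hv : ∀ (a : A k n) (i : Fin n), β (a • delList k [i]) = β' (a • delList k [i]) :=
    fun a i => by
      refine h.ext_right h' (smul_delList_mem k a [i]) (fun b => hvf a b i) fun b j => ?_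
      rw [← smul_del_eq_smul_delList, ← smul_del_eq_smul_delList, h.vector_vector,
        h'.vector_vector]
  refine LinearMap.ext fun x => ?_
  induction x using polyvector_induction with
  | add x x' hx hx' => rw [map_add, map_add, hx, hx']
  | basis a I _ =>
    have hI := smul_delList_mem k a I
    refine h.ext_right h' hI (fun b => ?_) fun b j => ?_
    · rw [h.antisymm _ _ _ _ hI (smul_delList_mem k b []),
        h'.antisymm _ _ _ _ hI (smul_delList_mem k b []), hf]
    · rw [h.antisymm _ _ _ _ hI (smul_delList_mem k b [j]),
        h'.antisymm _ _ _ _ hI (smul_delList_mem k b [j]), hv]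

/-! ### Explicit sums for the circle product and the bracket -/

/-- Moving `J` past the tail of `I` into the gap gives the stated order. The exponent is an integer
because `|J| - 1` is `-1` for empty `J`; `r` counts from `0`, hence `r + 1`. -/
theorem circPoly_smul_delList_eq_sum (a b : A k n) (I J : List (Fin n)) :
    circPoly k n (a • delList k I) (b • delList k J) = ∑ r : Fin I.length,
      (Int.negOnePow (((I.length : ℤ) - (r + 1)) * ((J.length : ℤ) - 1)) : ℤ) •
        (a * MvPolynomial.pderiv (I[r]'r.2) b) • delList k (I.take r ++ J ++ I.drop (r + 1)) := by
  rw [circPoly_smul_delList]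
  refine Finset.sum_congr rfl fun r _ => ?_
  obtain ⟨s, hs⟩ : ∃ s, I.length = r + s + 1 := ⟨I.length - (r + 1), by have := r.2; omega⟩
  have hs' : I.length - (r + 1) = s := by omega
  rw [delList_take_drop_append, smul_comm (a * _), smul_smul, ← pow_add, hs',
    negOnePow_eq_neg_one_pow]
  rw [show (I.length : ℤ) - (r + 1) = s by omega]
  have hl : Even I.length ↔ Even (r + s + 1 : ℕ) := by rw [← hs]
  simp only [Int.even_mul, Int.even_sub, Int.even_coe_nat, Nat.even_mul, Nat.even_add_one,
    Nat.even_add, hl, Int.not_even_one]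
  tauto

/-- With `l` counted from `0`, `(|J| - 1) + (|J| - (l + 1))` has the parity of `l`; this absorbs the
antisymmetrisation sign. -/
theorem negOnePow_smul_circPoly_eq_sum (a b : A k n) (I J : List (Fin n)) :
    (Int.negOnePow (((I.length : ℤ) - 1) * ((J.length : ℤ) - 1)) : ℤ) •
        circPoly k n (b • delList k J) (a • delList k I) = ∑ l : Fin J.length,
      (Int.negOnePow ((((l : ℤ) + 1) - 1) * ((I.length : ℤ) - 1)) : ℤ) •
        (b * MvPolynomial.pderiv (J[l]'l.2) a) • delList k (J.take l ++ I ++ J.drop (l + 1)) := by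
  rw [circPoly_smul_delList_eq_sum, Finset.smul_sum]
  refine Finset.sum_congr rfl fun l _ => ?_
  rw [smul_smul, ← Units.val_mul, ← Int.negOnePow_add]
  congr 2
  rw [Int.negOnePow_eq_iff]
  simp only [Int.even_mul, Int.even_sub, Int.even_add, Int.even_coe_nat, Int.not_even_one]
  tauto

end KoszulPoly

end

theorem proposition4p7 (k : Type*) [Field k] (n : ℕ) :
    -- `A[∂_1, …, ∂_n] = Hom_{A^e}(K, A)`, a complex with zero differential
    (Function.Injective (KoszulPoly.toCochain k n) ∧
      Set.range (KoszulPoly.toCochain k n) = KoszulPoly.cochains k n ∧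
      ∀ f ∈ KoszulPoly.cochains k n, f ∘ₗ KoszulPoly.koszulD k n = 0) ∧
    -- the `φ`-circle product
    (∀ (a b : KoszulPoly.A k n) (I J : List (Fin n)),
      KoszulPoly.circ J.length
          (KoszulPoly.toCochain k n (a • KoszulPoly.delList k I))
          (KoszulPoly.toCochain k n (b • KoszulPoly.delList k J)) =
        KoszulPoly.toCochain k n (∑ r : Fin I.length,
          (Int.negOnePow (((I.length : ℤ) - (r + 1)) * ((J.length : ℤ) - 1)) : ℤ) •
            (a * MvPolynomial.pderiv I[r] b) •
              KoszulPoly.delList k (I.take r ++ J ++ I.drop (r + 1)))) ∧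
    -- the `φ`-bracket
    (∀ (a b : KoszulPoly.A k n) (I J : List (Fin n)),
      KoszulPoly.bracket I.length J.length
          (KoszulPoly.toCochain k n (a • KoszulPoly.delList k I))
          (KoszulPoly.toCochain k n (b • KoszulPoly.delList k J)) =
        KoszulPoly.toCochain k n
          (∑ r : Fin I.length,
              (Int.negOnePow (((I.length : ℤ) - (r + 1)) * ((J.length : ℤ) - 1)) : ℤ) •
                (a * MvPolynomial.pderiv I[r] b) •
                  KoszulPoly.delList k (I.take r ++ J ++ I.drop (r + 1)) -
            ∑ l : Fin J.length,
              (Int.negOnePow ((((l : ℤ) + 1) - 1) * ((I.length : ℤ) - 1)) : ℤ) •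
                (b * MvPolynomial.pderiv J[l] a) •
                  KoszulPoly.delList k (J.take l ++ I ++ J.drop (l + 1)))) ∧
    -- the `φ`-bracket is the Schouten–Nijenhuis bracket
    ∃ β : KoszulPoly.Polyvector k n →ₗ[k] KoszulPoly.Polyvector k n →ₗ[k]
        KoszulPoly.Polyvector k n,
      KoszulPoly.IsSchoutenNijenhuis β ∧
      (∀ β', KoszulPoly.IsSchoutenNijenhuis β' → β' = β) ∧
      ∀ (p q : ℕ) (ω η : KoszulPoly.Polyvector k n),
        ω ∈ ⋀[KoszulPoly.A k n]^p (Fin n → KoszulPoly.A k n) →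
        η ∈ ⋀[KoszulPoly.A k n]^q (Fin n → KoszulPoly.A k n) →
        KoszulPoly.bracket p q (KoszulPoly.toCochain k n ω) (KoszulPoly.toCochain k n η) =
          KoszulPoly.toCochain k n (β ω η) := by
  refine ⟨⟨KoszulPoly.toCochain_injective k, KoszulPoly.range_toCochain k,
    fun f hf => KoszulPoly.cochains_comp_koszulD k hf⟩, fun a b I J => ?_, fun a b I J => ?_,
    KoszulPoly.schouten k n, KoszulPoly.isSchoutenNijenhuis_schouten k,
    fun β' h => h.unique (KoszulPoly.isSchoutenNijenhuis_schouten k), fun p q ω η hω hη => ?_⟩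
  · rw [KoszulPoly.circ_toCochain k _ (KoszulPoly.smul_delList_mem k b J),
      KoszulPoly.circPoly_smul_delList_eq_sum]
  · rw [KoszulPoly.toCochain_bracket k (KoszulPoly.smul_delList_mem k a I)
      (KoszulPoly.smul_delList_mem k b J), KoszulPoly.negOnePow_smul_circPoly_eq_sum,
      KoszulPoly.circPoly_smul_delList_eq_sum]
  · rw [KoszulPoly.toCochain_bracket k hω hη, KoszulPoly.schouten_eq k hω hη]
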